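/- For each positive integer $n$ let $\mathbf d=\mathbf d(n)=(d_1,\dots,d_n)$ be a sequence of non-negative integers with $d_1\ge d_2\ge\dots\ge d_n$ and $\|\mathbf d\|_1=\sum_{i=1}^n d_i$ even. Put $\delta(\mathbf d)=d_n$ and $J(\mathbf d)=\sum_{i=1}^{d_1}d_i$ (with $d_i=0$ for $i>n$), and let $P=P(\mathbf d)$ be the symmetric $n\times n$ matrix with $P_{jk}=\dfrac{d_jd_k}{\|\mathbf d\|_1+d_jd_k}$ for $j\ne k$ and $P_{jj}=0$. Let $\mathcal G(n,\mathbf d)$ denote a uniformly random simple graph on $[n]=\{1,\dots,n\}$ in which every vertex $i$ has degree $d_i$ and, for a symmetric $n\times n$ matrix $W$ with entries in $[0,1]$, let $\mathcal G(n,W)$ denote the random graph on $[n]$ in which each edge $jk$, $j<k$, is present independently with probability $W_{jk}$. Assume that, as $n\to\infty$, $J(\mathbf d)=o(\|\mathbf d\|_1)$ and $\log n=o(\delta(\mathbf d))$. Then there are symmetric matrices $W=W(n)\in[0,1]^{n\times n}$ with $$W_{jk}=(1+o(1))\bigl(1-e^{-P_{jk}}\bigr)\qquad\text{uniformly in } j,k\in[n],$$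 such that, for all sufficiently large $n$, a graph with degree sequence $\mathbf d$ exists and there is a coupling $(G_L,G)$ (a pair of random graphs on one probability space) with $G_L\sim\mathcal G(n,W)$ and $G\sim\mathcal G(n,\mathbf d)$, and such that $\mathbb P(G_L\subseteq G)\to1$ as $n\to\infty$. -/

import Mathlib

open Filter Topology MeasureTheory ProbabilityTheory Asymptotics

noncomputable section

namespace DegSeq

/-- The `ℓ¹`-norm `‖d‖₁ = ∑ i, d i`. -/
def norm1 {n : ℕ} (d : Fin n → ℕ) : ℕ := ∑ i, d i

/-- The maximum entry `Δ(d)`; it equals the first entry when `d` is non-increasing. -/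
def maxDeg {n : ℕ} (d : Fin n → ℕ) : ℕ := Finset.univ.sup d

/-- The minimum entry `δ(d)`; it equals the last entry when `d` is non-increasing. -/
def minDeg {n : ℕ} (d : Fin n → ℕ) : ℕ := ⨅ i, d i

/-- `J(d) = d₁ + d₂ + ⋯ + d_Δ` with `Δ = d₁`, for a non-increasing sequence `d`
(the index `i : Fin n` stands for the entry number `i + 1`). -/
def J {n : ℕ} (d : Fin n → ℕ) : ℕ := ∑ i : Fin n, if i.val < maxDeg d then d i else 0

/-- The matrix `P(d)`, with entries `d_j d_k / (‖d‖₁ + d_j d_k)` off the diagonal and `0` on it. -/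
def P {n : ℕ} (d : Fin n → ℕ) : Matrix (Fin n) (Fin n) ℝ :=
  Matrix.of fun j k =>
    if j = k then 0 else ((d j : ℝ) * d k) / ((norm1 d : ℝ) + (d j : ℝ) * d k)

/-- The graphs on `Fin n` in which every vertex `i` has degree `d i`. -/
def realizations {n : ℕ} (d : Fin n → ℕ) : Set (SimpleGraph (Fin n)) :=
  {G | ∀ i, (G.neighborSet i).ncard = d i}

/-- The law of `𝒢(n, d)`: the uniform probability measure on the graphs with degree sequence `d`
(it is the zero measure, hence not a probability measure, if there is no such graph). -/
def degreeModel {n : ℕ} (d : Fin n → ℕ) : Measure (SimpleGraph (Fin n)) :=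
  uniformOn (realizations d)

/-- The pairs `j < k`, standing for the edges `jk` of the complete graph. -/
abbrev Pairs (n : ℕ) : Type := {e : Fin n × Fin n // e.1 < e.2}

/-- The graph whose edges are the pairs `jk`, `j < k`, with `ω jk` true. -/
def graphOfPairs {n : ℕ} (ω : Pairs n → Prop) : SimpleGraph (Fin n) :=
  SimpleGraph.fromRel fun j k => ∃ h : j < k, ω ⟨(j, k), h⟩

/-- The law of `𝒢(n, W)`: every edge `jk`, `j < k`, is present with probability `W j k`,
independently of the others. -/
def edgeModel {n : ℕ} (W : Matrix (Fin n) (Fin n) unitInterval) :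
    Measure (SimpleGraph (Fin n)) :=
  (Measure.pi fun e : Pairs n => bernoulliMeasure True False (W e.1.1 e.1.2)).map graphOfPairs

/-- `γ` is (the joint law of) a coupling of the laws `μ` and `ν`. -/
structure IsCoupling {α β : Type*} [MeasurableSpace α] [MeasurableSpace β]
    (γ : Measure (α × β)) (μ : Measure α) (ν : Measure β) : Prop where
  isProbabilityMeasure : IsProbabilityMeasure γ
  fst_eq : γ.fst = μ
  snd_eq : γ.snd = ν

/-- `A = (1 + o(1)) B` for sequences of matrices, uniformly over the entries. -/
def UniformlyAsymptotic (A B : ∀ n : ℕ, Matrix (Fin n) (Fin n) ℝ) : Prop :=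
  ∀ ε : ℝ, 0 < ε → ∀ᶠ n in atTop, ∀ j k, |A n j k - B n j k| ≤ ε * |B n j k|

end DegSeq

end

/-! The edges of a uniformly random graph `G` with degree sequence `d` and `m = ‖d‖₁ / 2` edges are
exposed one at a time in uniformly random order. If `H` is the set of the first `t` edges, the next
edge is `jk` with probability (share of the graphs containing `H` that also contain `jk`) / (`m -
t`). Suppose every vertex `j` still has about `(1 - t/m) d_j` unexposed edges. Then a switching that
deletes `ja`, `kb`, `xy` and adds `jk`, `ax`, `by` bounds this share from below (`card_switch_le`),
and the probability is at least `(1 - ε/4) P_jk / m` (`pairP_le_nextEdge`). The hypothesis on `J`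
makes the number of forbidden choices of `xy` negligible.

Hence an independent sample from the fixed sub-probability weights `q = (1 - ε/4) P / m` can be
coupled with each exposure step so that it is empty, already exposed, or equal to the new edge
(`exists_step_coupling`). Iterating gives a set of independent samples inside `G`
(`exists_sampleSet_coupling`). If the number of samples is Poisson with mean `λ`, where `λ q = (1 -
ε) P`, then by Poisson splitting the edges occur independently, each with probability `1 - exp(-(1 -
ε) P_jk)` (`poisSet_void`, `poisSet_map_toGraph`).

Two failures remain. The Poisson number may exceed `(1 - ε/4) m`, which a Chernoff bound makes
unlikely. Or some vertex may lose its edges too fast: the unexposed part of a vertex's edges behaves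
like a sample without replacement, and an explicit supermartingale (`potential`) bounds the failure
probability by `m n exp(-c δ)` with `c > 0` depending on `ε`. This vanishes since `m ≤ n²` and `log
n = o(δ)`. A diagonal argument finally lets `ε` tend to zero. -/

noncomputable section

namespace DegSeq

/-! ### Finite distributions with real weights. -/

section FinitePMF

variable {α β : Type*} [Fintype α] [Fintype β]

/-- The probability mass function with the given real weights. -/
def realPMF (w : α → ℝ) (h0 : ∀ a, 0 ≤ w a) (h1 : ∑ a, w a = 1) : PMF α :=
  PMF.ofFintype (fun a => ENNReal.ofReal (w a)) (by
    rw [← ENNReal.ofReal_sum_of_nonneg fun a _ => h0 a, h1, ENNReal.ofReal_one])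

theorem realPMF_apply (w : α → ℝ) (h0 : ∀ a, 0 ≤ w a) (h1 : ∑ a, w a = 1) (a : α) :
    realPMF w h0 h1 a = ENNReal.ofReal (w a) := rfl

theorem realPMF_map_fst (w : α × β → ℝ) (h0 : ∀ a, 0 ≤ w a) (h1 : ∑ a, w a = 1) (u : α → ℝ)
    (hu0 : ∀ a, 0 ≤ u a) (hu1 : ∑ a, u a = 1) (hu : ∀ a, ∑ b, w (a, b) = u a) :
    (realPMF w h0 h1).map Prod.fst = realPMF u hu0 hu1 := by
  classical
  ext a
  rw [PMF.map_apply, realPMF_apply, tsum_fintype, Fintype.sum_prod_type, ← hu,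
    ENNReal.ofReal_sum_of_nonneg fun b _ => h0 _, Finset.sum_eq_single a]
  · simp [realPMF_apply]
  · intro b _ hb
    simp [hb.symm]
  · simp

theorem realPMF_map_snd (w : α × β → ℝ) (h0 : ∀ a, 0 ≤ w a) (h1 : ∑ a, w a = 1) (u : β → ℝ)
    (hu0 : ∀ a, 0 ≤ u a) (hu1 : ∑ a, u a = 1) (hu : ∀ b, ∑ a, w (a, b) = u b) :
    (realPMF w h0 h1).map Prod.snd = realPMF u hu0 hu1 := by
  classical
  ext a
  rw [PMF.map_apply, realPMF_apply, tsum_fintype, Fintype.sum_prod_type_right, ← hu,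
    ENNReal.ofReal_sum_of_nonneg fun b _ => h0 _, Finset.sum_eq_single a]
  · simp [realPMF_apply]
  · intro b _ hb
    simp [hb.symm]
  · simp

end FinitePMF

/-! ### Exposing a random edge set edge by edge, and the coupling with independent samples. -/

section EdgeProcess

variable {E : Type*} [DecidableEq E]

/-- The members of the family `R` that contain `H`. -/
def above (R : Finset (Finset E)) (H : Finset E) : Finset (Finset E) := R.filter (H ⊆ ·)

theorem mem_above {R : Finset (Finset E)} {H G : Finset E} :
    G ∈ above R H ↔ G ∈ R ∧ H ⊆ G := Finset.mem_filter

/-- The uniform distribution on `s`, and a point mass if `s` is empty. -/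
def unifPMF {α : Type*} [Inhabited α] (s : Finset α) : PMF α :=
  open Classical in if h : s.Nonempty then PMF.uniformOfFinset s h else PMF.pure default

theorem unifPMF_of_nonempty {α : Type*} [Inhabited α] {s : Finset α} (h : s.Nonempty) :
    unifPMF s = PMF.uniformOfFinset s h := dif_pos h

/-- The probability that `f` is the next edge exposed, when the edges of a uniformly random member
of `R` (all of whose members have `m` edges) are exposed in random order and those in `H` have been
exposed so far. -/
def nextEdge (R : Finset (Finset E)) (m : ℕ) (H : Finset E) (f : E) : ℝ :=
  if f ∈ H then 0
  else ((above R (insert f H)).card : ℝ) / ((above R H).card * ((m : ℝ) - H.card))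

variable {R : Finset (Finset E)} {m : ℕ} {H : Finset E}

theorem nextEdge_denom_pos (hH : (above R H).Nonempty) (hm : H.card < m) :
    0 < ((above R H).card : ℝ) * ((m : ℝ) - H.card) := by
  have h1 : (0 : ℝ) < (above R H).card := by exact_mod_cast hH.card_pos
  have h2 : (H.card : ℝ) < m := by exact_mod_cast hm
  exact mul_pos h1 (by linarith)

theorem nextEdge_nonneg (hm : H.card < m) (f : E) : 0 ≤ nextEdge R m H f := by
  have h2 : (H.card : ℝ) < m := by exact_mod_cast hm
  unfold nextEdge
  split_ifs
  · rfl
  · exact div_nonneg (by positivity) (mul_nonneg (by positivity) (by linarith))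

theorem card_sdiff_of_mem_above (hR : ∀ G ∈ R, G.card = m) {G : Finset E} (hG : G ∈ above R H) :
    ((G \ H).card : ℝ) = (m : ℝ) - H.card := by
  rw [mem_above] at hG
  have := Finset.card_sdiff_add_card_eq_card hG.2
  rw [hR G hG.1] at this
  rw [← this]
  push_cast
  ring

theorem above_insert_nonempty {f : E} (hf : nextEdge R m H f ≠ 0) :
    f ∉ H ∧ (above R (insert f H)).Nonempty := by
  unfold nextEdge at hf
  split_ifs at hf with h
  · exact absurd rfl hf
  · refine ⟨h, ?_⟩
    by_contra hne
    rw [Finset.not_nonempty_iff_eq_empty] at hne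
    simp [hne] at hf

variable [Fintype E]

/-- Double counting of the pairs `(G, f)` with `f ∈ G \ H`: the next edge is a uniform unexposed
edge of a uniform `G` above `H`. -/
theorem sum_nextEdge_mul (φ : E → ℝ) :
    ∑ f, nextEdge R m H f * φ f =
      (∑ G ∈ above R H, ∑ f ∈ G \ H, φ f) / ((above R H).card * ((m : ℝ) - H.card)) := by
  have key : ∑ G ∈ above R H, ∑ f ∈ G \ H, φ f =
      ∑ f, if f ∈ H then 0 else ((above R (insert f H)).card : ℝ) * φ f := by
    have : ∀ G ∈ above R H, ∑ f ∈ G \ H, φ f = ∑ f, if f ∈ G \ H then φ f else 0 := by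
      intro G _
      rw [← Finset.sum_filter]
      congr 1
      ext f
      simp
    rw [Finset.sum_congr rfl this, Finset.sum_comm]
    refine Finset.sum_congr rfl fun f _ => ?_
    split_ifs with hf
    · simp [hf]
    · rw [← Finset.sum_filter, Finset.sum_const, nsmul_eq_mul]
      congr 3
      ext G
      simp only [Finset.mem_filter, mem_above, Finset.mem_sdiff, Finset.insert_subset_iff]
      tauto
  rw [key, Finset.sum_div]
  refine Finset.sum_congr rfl fun f _ => ?_
  unfold nextEdge
  split_ifs
  · simp
  · ring

theorem sum_nextEdge (hR : ∀ G ∈ R, G.card = m) (hH : (above R H).Nonempty) (hm : H.card < m) :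
    ∑ f, nextEdge R m H f = 1 := by
  have := sum_nextEdge_mul (R := R) (m := m) (H := H) fun _ => 1
  simp only [mul_one] at this
  rw [this, div_eq_one_iff_eq (nextEdge_denom_pos hH hm).ne']
  calc ∑ G ∈ above R H, ∑ f ∈ G \ H, (1 : ℝ) = ∑ G ∈ above R H, ((m : ℝ) - H.card) :=
        Finset.sum_congr rfl fun G hG => by
          rw [← card_sdiff_of_mem_above hR hG]; simp
    _ = _ := by rw [Finset.sum_const, nsmul_eq_mul]

/-- The distribution of the next exposed edge. -/
def nextPMF (hR : ∀ G ∈ R, G.card = m) (hH : (above R H).Nonempty) (hm : H.card < m) : PMF E :=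
  realPMF (nextEdge R m H) (nextEdge_nonneg hm) (sum_nextEdge hR hH hm)

/-- This consistency keeps the second marginal uniform along the process: each pair of a graph `G`
above `H` and an edge of `G \ H` has the same weight, and `G \ H` always has `m - H.card` edges. -/
theorem nextPMF_bind_unifPMF (hR : ∀ G ∈ R, G.card = m) (hH : (above R H).Nonempty)
    (hm : H.card < m) :
    ((nextPMF hR hH hm).bind fun f => unifPMF (above R (insert f H))) = unifPMF (above R H) := by
  ext G
  have hterm : ∀ f, nextPMF hR hH hm f * unifPMF (above R (insert f H)) G =
      ENNReal.ofReal (if G ∈ above R H ∧ f ∈ G \ H then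
        (((above R H).card : ℝ) * ((m : ℝ) - H.card))⁻¹ else 0) := by
    intro f
    by_cases h0 : nextEdge R m H f = 0
    · rw [nextPMF, realPMF_apply, h0, ENNReal.ofReal_zero, zero_mul, if_neg, ENNReal.ofReal_zero]
      rintro ⟨hG, hf⟩
      rw [Finset.mem_sdiff] at hf
      have hG' : G ∈ above R (insert f H) := by
        rw [mem_above] at hG ⊢
        exact ⟨hG.1, Finset.insert_subset hf.1 hG.2⟩
      rw [nextEdge, if_neg hf.2, div_eq_zero_iff] at h0
      rcases h0 with h0 | h0
      · have : 0 < (above R (insert f H)).card := Finset.card_pos.2 ⟨G, hG'⟩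
        norm_cast at h0
        omega
      · exact (nextEdge_denom_pos hH hm).ne' h0
    · obtain ⟨hf, hne⟩ := above_insert_nonempty h0
      rw [unifPMF_of_nonempty hne, PMF.uniformOfFinset_apply, nextPMF, realPMF_apply]
      have hiff : G ∈ above R (insert f H) ↔ G ∈ above R H ∧ f ∈ G \ H := by
        simp only [mem_above, Finset.insert_subset_iff, Finset.mem_sdiff]
        tauto
      by_cases hG : G ∈ above R (insert f H)
      · rw [if_pos hG, if_pos (hiff.1 hG)]
        have hc : (0 : ℝ) < (above R (insert f H)).card := by exact_mod_cast hne.card_pos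
        rw [← ENNReal.ofReal_natCast, ← ENNReal.ofReal_inv_of_pos hc,
          ← ENNReal.ofReal_mul (nextEdge_nonneg hm f), nextEdge, if_neg hf]
        congr 1
        field_simp
      · rw [if_neg hG, if_neg (fun h => hG (hiff.2 h))]
        simp
  rw [PMF.bind_apply, tsum_fintype, Finset.sum_congr rfl fun f _ => hterm f,
    unifPMF_of_nonempty hH, PMF.uniformOfFinset_apply]
  have hpos := nextEdge_denom_pos hH hm
  by_cases hG : G ∈ above R H
  · rw [if_pos hG, ← ENNReal.ofReal_sum_of_nonneg]
    · simp only [hG, true_and]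
      rw [← Finset.sum_filter, Finset.sum_const, Finset.filter_mem_eq_inter, Finset.univ_inter,
        nsmul_eq_mul, card_sdiff_of_mem_above hR hG]
      have h1 : (0 : ℝ) < (above R H).card := by exact_mod_cast hH.card_pos
      have h2 : (0 : ℝ) < (m : ℝ) - H.card := by
        have : (H.card : ℝ) < m := by exact_mod_cast hm
        linarith
      rw [← ENNReal.ofReal_natCast (above R H).card, ← ENNReal.ofReal_inv_of_pos h1]
      congr 1
      field_simp
    · intro f _
      split_ifs
      · exact (inv_pos.2 hpos).le
      · rfl
  · simp [hG]

/-- The distribution `q` completed by the mass of "no edge". -/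
def samplePMF (q : E → ℝ) (h0 : ∀ f, 0 ≤ q f) (h1 : ∑ f, q f ≤ 1) : PMF (Option E) :=
  realPMF (fun o => o.elim (1 - ∑ f, q f) q)
    (by rintro (_ | f) <;> simp [h0, h1]) (by simp [Fintype.sum_option])

/-- A sample from `q` can be coupled with a sample from `p` such that it is equal to the latter,
or in `H`, or empty. -/
theorem exists_step_coupling (H : Finset E) (q p : E → ℝ) (hq0 : ∀ f, 0 ≤ q f)
    (hq1 : ∑ f, q f < 1) (hp0 : ∀ f, 0 ≤ p f) (hp1 : ∑ f, p f = 1)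
    (hqp : ∀ f, f ∉ H → q f ≤ p f) :
    ∃ σ : PMF (Option E × E), σ.map Prod.fst = samplePMF q hq0 hq1.le ∧
      σ.map Prod.snd = realPMF p hp0 hp1 ∧
      ∀ x ∈ σ.support, ∀ l, x.1 = some l → l ∈ H ∨ l = x.2 := by
  set q' : E → ℝ := fun f => if f ∈ H then 0 else q f with hq'
  have hq'le : ∀ f, q' f ≤ q f := by
    intro f; simp only [hq']; split_ifs <;> simp [hq0]
  have hq'0 : ∀ f, 0 ≤ q' f := by
    intro f; simp only [hq']; split_ifs <;> simp [hq0]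
  have hq'p : ∀ f, q' f ≤ p f := by
    intro f; simp only [hq']; split_ifs with h
    · exact hp0 f
    · exact hqp f h
  set D : ℝ := 1 - ∑ f, q' f with hD
  have hDpos : 0 < D := by
    have := Finset.sum_le_sum fun f (_ : f ∈ Finset.univ) => hq'le f
    linarith
  have hsum : ∑ f, (p f - q' f) = D := by rw [Finset.sum_sub_distrib, hp1]
  -- The part `q'` of `q` off `H` sits on the diagonal; what is left of the sample and of the edge
  -- is coupled independently. A sample differing from the edge thus comes from `q - q'`, which
  -- lives on `H`.
  set w : Option E × E → ℝ := fun x => (if x.1 = some x.2 then q' x.2 else 0) +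
    (x.1.elim (1 - ∑ f, q f) fun l => q l - q' l) * ((p x.2 - q' x.2) / D) with hw
  have hw0 : ∀ x, 0 ≤ w x := by
    rintro ⟨o, f⟩
    refine add_nonneg ?_ (mul_nonneg ?_ (div_nonneg ?_ hDpos.le))
    · dsimp only; split_ifs <;> simp [hq'0]
    · rcases o with _ | l
      · simp [hq1.le]
      · simp [hq'le]
    · simp [hq'p]
  have hfst : ∀ o : Option E, ∑ f, w (o, f) = o.elim (1 - ∑ f, q f) q := by
    intro o
    have h1 : ∑ f, (p f - q' f) / D = 1 := by rw [← Finset.sum_div, hsum, div_self hDpos.ne']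
    simp only [hw]
    rw [Finset.sum_add_distrib, ← Finset.mul_sum, h1]
    rcases o with _ | l <;> simp
  have hsnd : ∀ f : E, ∑ o, w (o, f) = p f := by
    intro f
    simp only [hw]
    rw [Finset.sum_add_distrib, ← Finset.sum_mul]
    have h1 : ∑ o : Option E, (o.elim (1 - ∑ f, q f) fun l => q l - q' l) = D := by
      rw [Fintype.sum_option]
      simp [Finset.sum_sub_distrib, hD]
    rw [h1, mul_div_cancel₀ _ hDpos.ne']
    simp
  have hw1 : ∑ x, w x = 1 := by
    rw [Fintype.sum_prod_type_right, Finset.sum_congr rfl fun f _ => hsnd f, hp1]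
  refine ⟨realPMF w hw0 hw1, realPMF_map_fst _ _ _ _ _ _ hfst, realPMF_map_snd _ _ _ _ _ _ hsnd,
    ?_⟩
  rintro ⟨o, f⟩ hx l rfl
  by_contra hl
  rw [not_or] at hl
  refine (PMF.mem_support_iff _ _).1 hx ?_
  rw [realPMF_apply]
  simp [hw, hl.1, hl.2, hq']

/-- The set obtained from `S` by adding `r` independent samples. -/
def sampleSet (Q : PMF (Option E)) : ℕ → Finset E → PMF (Finset E)
  | 0, S => PMF.pure S
  | r + 1, S => Q.bind fun o => sampleSet Q r (o.elim S fun f => insert f S)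

/-- The independent coupling. -/
def prodPMF {α β : Type*} (μ : PMF α) (ν : PMF β) : PMF (α × β) :=
  μ.bind fun a => ν.bind fun b => PMF.pure (a, b)

theorem prodPMF_map_fst {α β : Type*} (μ : PMF α) (ν : PMF β) :
    (prodPMF μ ν).map Prod.fst = μ := by
  simp [prodPMF, PMF.map_bind, PMF.pure_map]

theorem prodPMF_map_snd {α β : Type*} (μ : PMF α) (ν : PMF β) :
    (prodPMF μ ν).map Prod.snd = ν := by
  simp [prodPMF, PMF.map_bind, PMF.pure_map]

theorem toOuterMeasure_le_one {α : Type*} (μ : PMF α) (s : Set α) : μ.toOuterMeasure s ≤ 1 := by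
  rw [PMF.toOuterMeasure_apply, ← μ.tsum_coe]
  exact ENNReal.tsum_le_tsum fun a => Set.indicator_le_self _ _ _

/-- Induction on the number `r` of samples still to be drawn; `S ⊆ H` are the edges sampled so far.
`B r H` is a failure budget: once it reaches `1` any coupling will do, and otherwise the domination
needed for one coupled step holds and the budget is a supermartingale along the exposure. -/
theorem exists_sampleSet_coupling (hR : ∀ G ∈ R, G.card = m) (q : E → ℝ) (hq0 : ∀ f, 0 ≤ q f)
    (hq1 : ∑ f, q f < 1) (T : ℕ) (hT : T ≤ m) (B : ℕ → Finset E → ℝ)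
    (hB0 : ∀ r H, (above R H).Nonempty → H.card + r ≤ T → 0 ≤ B r H)
    (hB : ∀ r H, (above R H).Nonempty → H.card + r < T → 1 ≤ B (r + 1) H ∨
      ((∀ f, f ∉ H → q f ≤ nextEdge R m H f) ∧
        ∑ f, nextEdge R m H f * B r (insert f H) ≤ B (r + 1) H))
    (r : ℕ) (H S : Finset E) (hH : (above R H).Nonempty) (hr : H.card + r ≤ T) (hS : S ⊆ H) :
    ∃ γ : PMF (Finset E × Finset E),
      γ.map Prod.fst = sampleSet (samplePMF q hq0 hq1.le) r S ∧
      γ.map Prod.snd = unifPMF (above R H) ∧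
      γ.toOuterMeasure {x | ¬ x.1 ⊆ x.2} ≤ ENNReal.ofReal (B r H) := by
  induction r generalizing H S with
  | zero =>
    refine ⟨prodPMF (PMF.pure S) (unifPMF (above R H)), prodPMF_map_fst _ _, prodPMF_map_snd _ _,
      le_of_eq_of_le ?_ zero_le⟩
    rw [PMF.toOuterMeasure_apply_eq_zero_iff, Set.disjoint_left]
    rintro ⟨A, G⟩ hx
    simp only [prodPMF, PMF.pure_bind, PMF.mem_support_bind_iff, PMF.mem_support_pure_iff,
      Prod.mk.injEq, unifPMF_of_nonempty hH, PMF.mem_support_uniformOfFinset_iff] at hx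
    obtain ⟨G', hG', rfl, rfl⟩ := hx
    simpa using hS.trans (mem_above.1 hG').2
  | succ r ih =>
    rcases hB r H hH (by omega) with hbad | ⟨hgood, hstep⟩
    · refine ⟨prodPMF _ _, prodPMF_map_fst _ _, prodPMF_map_snd _ _,
        (toOuterMeasure_le_one _ _).trans ?_⟩
      simpa using hbad
    · have hm : H.card < m := by omega
      obtain ⟨σ, hσ1, hσ2, hσ3⟩ := exists_step_coupling H q (nextEdge R m H) hq0 hq1
        (nextEdge_nonneg hm) (sum_nextEdge hR hH hm) hgood
      have hne : ∀ x ∈ σ.support, nextEdge R m H x.2 ≠ 0 := by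
        intro x hx h0
        have h1 : x.2 ∈ (σ.map Prod.snd).support := by
          rw [PMF.mem_support_map_iff]
          exact ⟨x, hx, rfl⟩
        rw [hσ2, PMF.mem_support_iff, realPMF_apply, h0] at h1
        simp at h1
      have hcard : ∀ x ∈ σ.support, (insert x.2 H).card = H.card + 1 := fun x hx =>
        Finset.card_insert_of_notMem (above_insert_nonempty (hne x hx)).1
      have hex : ∀ x : Option E × E, ∃ γ : PMF (Finset E × Finset E), x ∈ σ.support →
          γ.map Prod.fst = sampleSet (samplePMF q hq0 hq1.le) r
            (x.1.elim S fun f => insert f S) ∧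
          γ.map Prod.snd = unifPMF (above R (insert x.2 H)) ∧
          γ.toOuterMeasure {x | ¬ x.1 ⊆ x.2} ≤ ENNReal.ofReal (B r (insert x.2 H)) := by
        intro x
        by_cases hx : x ∈ σ.support
        · obtain ⟨γ, hγ⟩ := ih (insert x.2 H) (x.1.elim S fun f => insert f S)
            (above_insert_nonempty (hne x hx)).2 (by rw [hcard x hx]; omega) (by
              rcases h : x.1 with _ | l
              · exact hS.trans (Finset.subset_insert _ _)
              · rw [Option.elim_some, Finset.insert_subset_iff]
                refine ⟨?_, hS.trans (Finset.subset_insert _ _)⟩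
                rcases hσ3 x hx l h with h | h
                · exact Finset.mem_insert_of_mem h
                · rw [h]; exact Finset.mem_insert_self _ _)
          exact ⟨γ, fun _ => hγ⟩
        · exact ⟨PMF.pure default, fun h => absurd h hx⟩
      choose γ hγ using hex
      -- The couplings `γ x` have the right marginals only for `x` in the support of `σ`, so
      -- mixtures are compared there.
      have hcongr : ∀ {δ : Type _} (f g : Option E × E → PMF δ),
          (∀ x ∈ σ.support, f x = g x) → σ.bind f = σ.bind g := by
        intro δ f g h
        ext a
        rw [PMF.bind_apply, PMF.bind_apply]
        refine tsum_congr fun x => ?_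
        by_cases hx : σ x = 0
        · simp [hx]
        · rw [h x hx]
      refine ⟨σ.bind γ, ?_, ?_, ?_⟩
      · rw [PMF.map_bind, hcongr _ _ fun x hx => (hγ x hx).1, sampleSet, ← hσ1, PMF.bind_map]
        rfl
      · rw [PMF.map_bind, hcongr _ _ fun x hx => (hγ x hx).2.1, ← nextPMF_bind_unifPMF hR hH hm,
          nextPMF, ← hσ2, PMF.bind_map]
        rfl
      · have h1 : (σ.map Prod.snd).bind (fun _ => PMF.pure ()) = PMF.pure () := PMF.bind_const _ _
        calc (σ.bind γ).toOuterMeasure {x | ¬ x.1 ⊆ x.2}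
            = ∑' x, σ x * (γ x).toOuterMeasure {x | ¬ x.1 ⊆ x.2} :=
              PMF.toOuterMeasure_bind_apply _ _ _
          _ ≤ ∑' x, σ x * ENNReal.ofReal (B r (insert x.2 H)) := by
              refine ENNReal.tsum_le_tsum fun x => ?_
              by_cases hx : σ x = 0
              · simp [hx]
              · exact mul_le_mul_right (hγ x hx).2.2 _
          _ = ∑ f, (σ.map Prod.snd) f * ENNReal.ofReal (B r (insert f H)) := by
              simp only [PMF.map_apply, tsum_fintype, Finset.sum_mul]
              rw [Finset.sum_comm]
              refine Finset.sum_congr rfl fun x _ => ?_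
              simp [ite_mul]
          _ = ENNReal.ofReal (∑ f, nextEdge R m H f * B r (insert f H)) := by
              rw [hσ2, ENNReal.ofReal_sum_of_nonneg]
              · refine Finset.sum_congr rfl fun f _ => ?_
                rw [realPMF_apply, ENNReal.ofReal_mul (nextEdge_nonneg hm f)]
              · intro f _
                by_cases h0 : nextEdge R m H f = 0
                · simp [h0]
                · obtain ⟨h1, h2⟩ := above_insert_nonempty h0
                  refine mul_nonneg (nextEdge_nonneg hm f) (hB0 _ _ h2 ?_)
                  rw [Finset.card_insert_of_notMem h1]
                  omega
          _ ≤ _ := ENNReal.ofReal_le_ofReal hstep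

end EdgeProcess

/-! ### A supermartingale controlling the unexposed edges in given sets. -/

section Potential

variable {E : Type*} [DecidableEq E] {R : Finset (Finset E)} {m : ℕ} {H : Finset E}
  {ι : Type*} [Fintype ι]

/-- A bound for the probability that within `r` further steps of the exposure process starting from
`H`, some `A j` has too few unexposed edges (`C j t` being the penalty factors). -/
def potential (m : ℕ) (y : ℝ) (A : ι → Finset E) (a : ι → ℕ) (C : ι → ℕ → ℝ) (r : ℕ)
    (H : Finset E) : ℝ :=
  ∑ i ∈ Finset.range r, ∑ j, C j (H.card + i) *
    (1 - (1 - y) * ((m - H.card - i) / (m - H.card))) ^ (a j - (H ∩ A j).card)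

theorem potential_base_bounds {y : ℝ} (hy0 : 0 < y) (hy1 : y ≤ 1) {t i : ℕ} (h : t + i < m) :
    0 ≤ 1 - (1 - y) * (((m : ℝ) - t - i) / (m - t)) ∧
      1 - (1 - y) * (((m : ℝ) - t - i) / (m - t)) ≤ 1 := by
  have h' : (t : ℝ) + i < m := by exact_mod_cast h
  have hi : (0 : ℝ) ≤ i := by positivity
  have h1 : ((m : ℝ) - t - i) / (m - t) ≤ 1 := by
    rw [div_le_one (by linarith)]; linarith
  have h0 : 0 ≤ ((m : ℝ) - t - i) / (m - t) := div_nonneg (by linarith) (by linarith)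
  constructor
  · nlinarith
  · nlinarith

theorem potential_nonneg {y : ℝ} (hy0 : 0 < y) (hy1 : y ≤ 1) (A : ι → Finset E) (a : ι → ℕ)
    (C : ι → ℕ → ℝ) (hC : ∀ j t, 0 ≤ C j t) (r : ℕ) (h : H.card + r ≤ m) :
    0 ≤ potential m y A a C r H := by
  refine Finset.sum_nonneg fun i hi => Finset.sum_nonneg fun j _ => mul_nonneg (hC _ _)
    (pow_nonneg (potential_base_bounds hy0 hy1 ?_).1 _)
  rw [Finset.mem_range] at hi
  omega

/-- The term `i = 0` has base exactly `y`, so a violation at the present time already uses up the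
whole budget. -/
theorem one_le_potential {y : ℝ} (hy0 : 0 < y) (hy1 : y ≤ 1) (A : ι → Finset E) (a : ι → ℕ)
    (C : ι → ℕ → ℝ) (hC : ∀ j t, 0 ≤ C j t) (r : ℕ) (h : H.card + r < m)
    (hbad : ∃ j, 1 ≤ C j H.card * y ^ (a j - (H ∩ A j).card)) :
    1 ≤ potential m y A a C (r + 1) H := by
  obtain ⟨j, hj⟩ := hbad
  have hpos : (m : ℝ) - H.card ≠ 0 := by
    have : (H.card : ℝ) < m := by exact_mod_cast (by omega : H.card < m)
    linarith
  have hterm : ∀ i ∈ Finset.range (r + 1), ∀ j, 0 ≤ C j (H.card + i) *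
      (1 - (1 - y) * (((m : ℝ) - H.card - i) / (m - H.card))) ^ (a j - (H ∩ A j).card) := by
    intro i hi j
    rw [Finset.mem_range] at hi
    exact mul_nonneg (hC _ _) (pow_nonneg (potential_base_bounds hy0 hy1 (by omega)).1 _)
  calc 1 ≤ C j (H.card + 0) *
      (1 - (1 - y) * (((m : ℝ) - H.card - (0 : ℕ)) / (m - H.card))) ^ (a j - (H ∩ A j).card) := by
        simpa [div_self hpos] using hj
    _ ≤ ∑ j, C j (H.card + 0) *
      (1 - (1 - y) * (((m : ℝ) - H.card - (0 : ℕ)) / (m - H.card))) ^ (a j - (H ∩ A j).card) :=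
        Finset.single_le_sum (f := fun j => C j (H.card + 0) *
          (1 - (1 - y) * (((m : ℝ) - H.card - (0 : ℕ)) / (m - H.card))) ^ (a j - (H ∩ A j).card))
          (fun j _ => hterm 0 (by simp) j) (Finset.mem_univ j)
    _ ≤ _ := Finset.single_le_sum (f := fun i : ℕ => ∑ j, C j (H.card + i) *
          (1 - (1 - y) * (((m : ℝ) - H.card - i) / (m - H.card))) ^ (a j - (H ∩ A j).card))
          (fun i hi => Finset.sum_nonneg fun j _ => hterm i hi j) (by simp)

variable [Fintype E]

/-- The first two terms of the binomial expansion. -/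
theorem pow_succ_add_mul_le (y c : ℝ) (hy : 0 ≤ y) (hc : 0 ≤ c) (n : ℕ) :
    y ^ (n + 1) + (n + 1) * y ^ n * c ≤ (y + c) ^ (n + 1) := by
  induction n with
  | zero => simp
  | succ n ih =>
    have h1 := mul_le_mul_of_nonneg_right ih (add_nonneg hy hc)
    have h2 : 0 ≤ ((n : ℝ) + 1) * y ^ n * c * c := by positivity
    rw [pow_succ (y + c)]
    refine le_trans ?_ h1
    push_cast
    have e1 : y ^ (n + 1 + 1) = y ^ n * y * y := by ring
    have e2 : y ^ (n + 1) = y ^ n * y := by ring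
    rw [e1, e2]
    nlinarith [h2]

/-- One step of the exposure process does not increase the (suitably rescaled) generating function
of the number of edges of `A` that are still to be exposed. -/
theorem sum_nextEdge_mul_pow_le (hR : ∀ G ∈ R, G.card = m) (hH : (above R H).Nonempty)
    (hm : H.card < m) (A : Finset E) (a : ℕ) (hA : ∀ G ∈ R, (G ∩ A).card = a) (y : ℝ)
    (hy0 : 0 ≤ y) (hy1 : y ≤ 1) :
    ∑ f, nextEdge R m H f * y ^ (a - (insert f H ∩ A).card) ≤
      (y + (1 - y) / ((m : ℝ) - H.card)) ^ (a - (H ∩ A).card) := by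
  set ρ := a - (H ∩ A).card with hρ
  set k : ℝ := (m : ℝ) - H.card with hk
  have hkpos : 0 < k := by
    have : (H.card : ℝ) < m := by exact_mod_cast hm
    linarith
  have hcpos : (0 : ℝ) < (above R H).card := by exact_mod_cast hH.card_pos
  -- Whatever `G` is, exactly `ρ` of its `k` unexposed edges lie in `A`; exposing one of these
  -- lowers the exponent by one, and the others leave it unchanged.
  have hG : ∀ G ∈ above R H, ∑ f ∈ G \ H, y ^ (a - (insert f H ∩ A).card) =
      ρ * y ^ (ρ - 1) + (k - ρ) * y ^ ρ := by
    intro G hG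
    have hcard : (((G \ H) ∩ A).card : ℝ) = ρ := by
      rw [mem_above] at hG
      have h1 : G ∩ A = ((G \ H) ∩ A) ∪ (H ∩ A) := by
        rw [← Finset.union_inter_distrib_right, Finset.sdiff_union_of_subset hG.2]
      have h2 : Disjoint ((G \ H) ∩ A) (H ∩ A) :=
        Finset.disjoint_of_subset_left Finset.inter_subset_left
          (Finset.disjoint_of_subset_right Finset.inter_subset_left Finset.sdiff_disjoint)
      have h3 := Finset.card_union_of_disjoint h2
      rw [← h1, hA G hG.1] at h3
      rw [hρ, h3, Nat.add_sub_cancel]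
    have hcard' : (((G \ H) \ A).card : ℝ) = k - ρ := by
      rw [hk, ← card_sdiff_of_mem_above hR hG, ← hcard,
        ← Finset.card_sdiff_add_card_inter (G \ H) A]
      push_cast
      ring
    rw [← Finset.sum_sdiff (Finset.inter_subset_left : (G \ H) ∩ A ⊆ G \ H),
      Finset.sdiff_inter_self_left, ← hcard', ← hcard, add_comm]
    congr 1
    · rw [← nsmul_eq_mul]
      refine Finset.sum_eq_card_nsmul fun f hf => ?_
      rw [Finset.mem_inter, Finset.mem_sdiff] at hf
      rw [Finset.insert_inter_of_mem hf.2, Finset.card_insert_of_notMem (by simp [hf.1.2])]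
      rfl
    · rw [← nsmul_eq_mul]
      refine Finset.sum_eq_card_nsmul fun f hf => ?_
      rw [Finset.mem_sdiff] at hf
      rw [Finset.insert_inter_of_notMem hf.2]
  rw [sum_nextEdge_mul, Finset.sum_congr rfl hG, Finset.sum_const, nsmul_eq_mul,
    mul_div_mul_left _ _ hcpos.ne', ← hk]
  rcases ρ with _ | n
  · simp [div_self hkpos.ne']
  · refine le_trans (le_of_eq ?_) (pow_succ_add_mul_le y ((1 - y) / k) hy0
      (div_nonneg (by linarith) hkpos.le) n)
    rw [Nat.add_sub_cancel]
    push_cast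
    field_simp
    ring

/-- One step replaces a base `z` by `z + (1 - z) / (m - t)`. This carries the `i`-th term at time `t
+ 1` to the term `i + 1` at time `t`, because the survival ratios `(m - t - i - 1) / (m - t - 1)`
and `(m - t - 1) / (m - t)` telescope. -/
theorem sum_nextEdge_mul_potential_le (hR : ∀ G ∈ R, G.card = m) (hH : (above R H).Nonempty)
    {y : ℝ} (hy0 : 0 < y) (hy1 : y ≤ 1) (A : ι → Finset E) (a : ι → ℕ)
    (hA : ∀ j, ∀ G ∈ R, (G ∩ A j).card = a j)
    (C : ι → ℕ → ℝ) (hC : ∀ j t, 0 ≤ C j t) (r : ℕ) (h : H.card + r < m) :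
    ∑ f, nextEdge R m H f * potential m y A a C r (insert f H) ≤
      potential m y A a C (r + 1) H := by
  have hm : H.card < m := by omega
  have hexp : ∀ f, nextEdge R m H f * potential m y A a C r (insert f H) =
      ∑ i ∈ Finset.range r, ∑ j, C j (H.card + (i + 1)) * (nextEdge R m H f *
        (1 - (1 - y) * (((m : ℝ) - (H.card + 1 : ℕ) - i) / (m - (H.card + 1 : ℕ)))) ^
          (a j - (insert f H ∩ A j).card)) := by
    intro f
    by_cases h0 : nextEdge R m H f = 0
    · simp [h0]
    · rw [potential, Finset.card_insert_of_notMem (above_insert_nonempty h0).1, Finset.mul_sum]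
      refine Finset.sum_congr rfl fun i _ => ?_
      rw [Finset.mul_sum]
      refine Finset.sum_congr rfl fun j _ => ?_
      rw [add_assoc H.card 1 i, add_comm 1 i]
      ring
  rw [Finset.sum_congr rfl fun f _ => hexp f, Finset.sum_comm, potential, Finset.sum_range_succ']
  refine le_add_of_le_of_nonneg ?_ (Finset.sum_nonneg fun j _ => mul_nonneg (hC _ _)
    (pow_nonneg (potential_base_bounds hy0 hy1 (by omega)).1 _))
  refine Finset.sum_le_sum fun i hi => ?_
  rw [Finset.mem_range] at hi
  rw [Finset.sum_comm]
  refine Finset.sum_le_sum fun j _ => ?_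
  rw [← Finset.mul_sum]
  refine mul_le_mul_of_nonneg_left ?_ (hC _ _)
  have hb := potential_base_bounds (m := m) hy0 hy1 (t := H.card + 1) (i := i) (by omega)
  refine (sum_nextEdge_mul_pow_le hR hH hm (A j) (a j) (hA j) _ hb.1 hb.2).trans
    (le_of_eq ?_)
  congr 1
  have h1 : ((H.card + i + 1 : ℕ) : ℝ) < m := by exact_mod_cast (by omega : H.card + i + 1 < m)
  have h2 : (0 : ℝ) ≤ i := by positivity
  push_cast at h1 ⊢
  have h3 : (m : ℝ) - H.card ≠ 0 := by linarith
  have h4 : (m : ℝ) - (H.card + 1) ≠ 0 := by linarith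
  field_simp
  ring

end Potential

/-! ### Sums of few degrees are at most `J`. -/

section MaxDegree

variable {n : ℕ} {d : Fin n → ℕ}

/-- Exchange argument: if `maxDeg d < n`, the entry `c` just after the initial segment `I` separates
the entries of `S \ I` from those of `I \ S`, and the former are not more numerous. Otherwise `I` is
everything. -/
theorem sum_le_J (hd : Antitone d) (S : Finset (Fin n)) (hS : S.card ≤ maxDeg d) :
    ∑ i ∈ S, d i ≤ J d := by
  classical
  set I : Finset (Fin n) := Finset.univ.filter fun i => i.val < maxDeg d with hI
  have hJ : J d = ∑ i ∈ I, d i := by rw [J, hI, Finset.sum_filter]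
  rw [hJ, ← Finset.sum_inter_add_sum_sdiff S I, ← Finset.sum_inter_add_sum_sdiff I S,
    Finset.inter_comm I S]
  refine Nat.add_le_add_left ?_ _
  rcases lt_or_ge (maxDeg d) n with h | h
  · set c := d ⟨maxDeg d, h⟩ with hc
    have hIcard : I.card = maxDeg d := by
      rw [hI, Fin.card_filter_val_lt, min_eq_right h.le]
    have h1 : ∑ i ∈ S \ I, d i ≤ (S \ I).card • c := by
      refine Finset.sum_le_card_nsmul _ _ _ fun i hi => hd ?_
      rw [Finset.mem_sdiff, hI, Finset.mem_filter] at hi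
      rw [Fin.le_def]
      simpa using hi.2
    have h2 : (I \ S).card • c ≤ ∑ i ∈ I \ S, d i := by
      refine Finset.card_nsmul_le_sum _ _ _ fun i hi => hd ?_
      rw [Finset.mem_sdiff, hI, Finset.mem_filter] at hi
      rw [Fin.le_def]
      exact hi.1.2.le
    have h3 : (S \ I).card ≤ (I \ S).card := by
      have e1 := Finset.card_sdiff_add_card_inter S I
      have e2 := Finset.card_sdiff_add_card_inter I S
      rw [Finset.inter_comm] at e2
      omega
    exact h1.trans ((Nat.mul_le_mul_right c h3).trans h2)
  · have : S \ I = ∅ := by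
      rw [Finset.sdiff_eq_empty_iff_subset]
      intro i _
      rw [hI, Finset.mem_filter]
      exact ⟨Finset.mem_univ _, i.isLt.trans_le h⟩
    simp [this]

theorem le_J (hd : Antitone d) (i : Fin n) : d i ≤ J d := by
  rcases Nat.eq_zero_or_pos (d i) with h | h
  · omega
  · have h1 : d i ≤ maxDeg d := Finset.le_sup (Finset.mem_univ i)
    simpa using sum_le_J hd {i} (by rw [Finset.card_singleton]; exact h.trans_le h1)

end MaxDegree

/-! ### Degrees and arcs of edge sets, and existence of a realization. -/

section EdgeSets

variable {V : Type*} [DecidableEq V]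

/-- The degree of `v` in the edge set `A`. -/
def edgeDeg (A : Finset (Sym2 V)) (v : V) : ℕ := (A.filter (v ∈ ·)).card

theorem edgeDeg_mono {A B : Finset (Sym2 V)} (h : A ⊆ B) (v : V) : edgeDeg A v ≤ edgeDeg B v :=
  Finset.card_le_card (Finset.filter_subset_filter _ h)

theorem edgeDeg_union {A B : Finset (Sym2 V)} (h : Disjoint A B) (v : V) :
    edgeDeg (A ∪ B) v = edgeDeg A v + edgeDeg B v := by
  rw [edgeDeg, Finset.filter_union, Finset.card_union_of_disjoint
    (Finset.disjoint_filter_filter h)]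
  rfl

theorem edgeDeg_sdiff {A B : Finset (Sym2 V)} (h : B ⊆ A) (v : V) :
    edgeDeg (A \ B) v + edgeDeg B v = edgeDeg A v := by
  rw [← edgeDeg_union Finset.sdiff_disjoint, Finset.sdiff_union_of_subset h]

theorem edgeDeg_insert {A : Finset (Sym2 V)} {u w : V} (h : s(u, w) ∉ A) (huw : u ≠ w) (v : V) :
    edgeDeg (insert s(u, w) A) v =
      edgeDeg A v + ((if v = u then 1 else 0) + if v = w then 1 else 0) := by
  rw [Finset.insert_eq, edgeDeg_union (by simpa using h), add_comm]
  congr 1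
  rw [edgeDeg, Finset.filter_singleton]
  by_cases h1 : v = u
  · subst h1
    simp [huw]
  · by_cases h2 : v = w
    · subst h2
      simp [huw.symm]
    · simp [h1, h2]

theorem edgeDeg_empty (v : V) : edgeDeg (∅ : Finset (Sym2 V)) v = 0 := by simp [edgeDeg]

variable [Fintype V]

/-- The neighbours of `v` in the edge set `A`. -/
def nbrs (A : Finset (Sym2 V)) (v : V) : Finset V := Finset.univ.filter fun a => s(v, a) ∈ A

/-- The oriented edges of the edge set `A`. -/
def arcs (A : Finset (Sym2 V)) : Finset (V × V) := Finset.univ.filter fun x => s(x.1, x.2) ∈ A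

@[simp] theorem mem_nbrs {A : Finset (Sym2 V)} {v a : V} : a ∈ nbrs A v ↔ s(v, a) ∈ A := by
  simp [nbrs]

@[simp] theorem mem_arcs {A : Finset (Sym2 V)} {x : V × V} : x ∈ arcs A ↔ s(x.1, x.2) ∈ A := by
  simp [arcs]

theorem card_nbrs (A : Finset (Sym2 V)) (v : V) : (nbrs A v).card = edgeDeg A v := by
  refine Finset.card_bij (fun a _ => s(v, a)) ?_ ?_ ?_
  · intro a ha
    simpa using ha
  · intro a _ b _ h
    exact Sym2.congr_right.1 h
  · intro e he
    rw [Finset.mem_filter] at he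
    obtain ⟨a, rfl⟩ := he.2
    exact ⟨a, by simpa using he.1, rfl⟩

theorem card_arcs_filter (A : Finset (Sym2 V)) (S : Finset V) :
    ((arcs A).filter fun x => x.1 ∈ S).card = ∑ v ∈ S, edgeDeg A v := by
  have : (arcs A).filter (fun x => x.1 ∈ S) =
      (S.sigma fun v => nbrs A v).map (Equiv.sigmaEquivProd V V).toEmbedding := by
    ext ⟨x, y⟩
    simp [and_comm]
  rw [this, Finset.card_map, Finset.card_sigma]
  exact Finset.sum_congr rfl fun v _ => card_nbrs A v

theorem card_arcs (A : Finset (Sym2 V)) : (arcs A).card = ∑ v, edgeDeg A v := by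
  simpa using card_arcs_filter A Finset.univ

theorem sum_edgeDeg {A : Finset (Sym2 V)} (hA : ∀ e ∈ A, ¬ e.IsDiag) :
    ∑ v, edgeDeg A v = 2 * A.card := by
  simp only [edgeDeg, Finset.card_filter]
  rw [Finset.sum_comm]
  have : ∀ e ∈ A, (∑ v : V, if v ∈ e then 1 else 0) = 2 := by
    intro e he
    rw [← Finset.card_filter, ← Sym2.card_toFinset_of_not_isDiag e (hA e he)]
    congr 1
    ext v
    simp
  rw [Finset.sum_congr rfl this]
  simp [mul_comm]

/-- The edge sets of the simple graphs with degree sequence `d`. -/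
def edgeFamily (d : V → ℕ) : Finset (Finset (Sym2 V)) :=
  Finset.univ.filter fun G => (∀ e ∈ G, ¬ e.IsDiag) ∧ ∀ v, edgeDeg G v = d v

theorem mem_edgeFamily {d : V → ℕ} {G : Finset (Sym2 V)} :
    G ∈ edgeFamily d ↔ (∀ e ∈ G, ¬ e.IsDiag) ∧ ∀ v, edgeDeg G v = d v := by
  simp [edgeFamily]

/-- `K` bounds the sum of `d` over closed neighbourhoods in graphs with degrees at most `d`. -/
def NbhdBound (d : V → ℕ) (K : ℕ) : Prop :=
  ∀ G : Finset (Sym2 V), (∀ v, edgeDeg G v ≤ d v) → ∀ a, ∑ v ∈ insert a (nbrs G a), d v ≤ K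

/-- The arcs `(x, y)` of `A` such that `ax` and `by` can be added to `G`. -/
def switchArcs (G A : Finset (Sym2 V)) (a b : V) : Finset (V × V) :=
  (arcs A).filter fun x => x.1 ∉ insert a (nbrs G a) ∧ x.2 ∉ insert b (nbrs G b)

theorem mem_switchArcs {G A : Finset (Sym2 V)} {a b : V} {x : V × V} :
    x ∈ switchArcs G A a b ↔ s(x.1, x.2) ∈ A ∧ (x.1 ≠ a ∧ s(a, x.1) ∉ G) ∧
      (x.2 ≠ b ∧ s(b, x.2) ∉ G) := by
  simp [switchArcs]

/-- Each of the two conditions excludes the arcs with one end in a closed neighbourhood, and these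
are at most the degree sum over it. -/
theorem card_arcs_le_card_switchArcs {d : V → ℕ} {K : ℕ} (hK : NbhdBound d K)
    {G A : Finset (Sym2 V)} (hG : ∀ v, edgeDeg G v ≤ d v) (hA : A ⊆ G) (a b : V) :
    (arcs A).card ≤ (switchArcs G A a b).card + 2 * K := by
  have hbound : ∀ c, ((arcs A).filter fun x => x.1 ∈ insert c (nbrs G c)).card ≤ K := by
    intro c
    rw [card_arcs_filter]
    exact (Finset.sum_le_sum fun v _ => (edgeDeg_mono hA v).trans (hG v)).trans (hK G hG c)
  have hbound' : ∀ c, ((arcs A).filter fun x => x.2 ∈ insert c (nbrs G c)).card ≤ K := by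
    intro c
    refine le_trans (le_of_eq ?_) (hbound c)
    refine Finset.card_bij (fun x _ => x.swap) ?_ ?_ ?_
    · rintro ⟨x, y⟩ h
      simpa [Sym2.eq_swap] using h
    · intro x _ y _ h
      exact Prod.swap_injective h
    · rintro ⟨x, y⟩ h
      exact ⟨(y, x), by simpa [Sym2.eq_swap] using h, rfl⟩
  have hsub : arcs A ⊆ switchArcs G A a b ∪
      (((arcs A).filter fun x => x.1 ∈ insert a (nbrs G a)) ∪
        ((arcs A).filter fun x => x.2 ∈ insert b (nbrs G b))) := by
    intro x hx
    simp only [switchArcs, Finset.mem_union, Finset.mem_filter, hx, true_and]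
    tauto
  have h1 := Finset.card_le_card hsub
  have h2 := Finset.card_union_le (switchArcs G A a b)
    (((arcs A).filter fun x => x.1 ∈ insert a (nbrs G a)) ∪
        ((arcs A).filter fun x => x.2 ∈ insert b (nbrs G b)))
  have h3 := Finset.card_union_le ((arcs A).filter fun x => x.1 ∈ insert a (nbrs G a))
        ((arcs A).filter fun x => x.2 ∈ insert b (nbrs G b))
  have h4 := hbound a
  have h5 := hbound' b
  omega

/-- Take a graph with degrees at most `d` and the most edges. If it fell short, its deficient
vertices would all lie in the closed neighbourhood of one of them, so the total deficiency would be
at most `K`. More than `2 * K` arcs remain, so some edge `xy` can be replaced by `ux` and `vy`,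
which gains an edge. -/
theorem edgeFamily_nonempty {d : V → ℕ} {K : ℕ} (hK : NbhdBound d K) (heven : Even (∑ v, d v))
    (hKd : 3 * K < ∑ v, d v) : (edgeFamily d).Nonempty := by
  set F : Finset (Finset (Sym2 V)) := Finset.univ.filter fun G =>
    (∀ e ∈ G, ¬ e.IsDiag) ∧ ∀ v, edgeDeg G v ≤ d v with hF
  have hFne : F.Nonempty := ⟨∅, by simp [hF, edgeDeg_empty]⟩
  obtain ⟨G, hGF, hmax⟩ := F.exists_max_image Finset.card hFne
  have hG := hGF
  rw [hF, Finset.mem_filter] at hG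
  obtain ⟨-, hdiag, hdeg⟩ := hG
  have hlarger : ∀ G', (∀ e ∈ G', ¬ e.IsDiag) → (∀ v, edgeDeg G' v ≤ d v) → G'.card ≤ G.card :=
    fun G' h1 h2 => hmax G' (by simp [hF]; exact ⟨h1, h2⟩)
  by_contra hempty
  have hsumG := sum_edgeDeg hdiag
  obtain ⟨u, hu⟩ : ∃ u, edgeDeg G u < d u := by
    by_contra! h
    exact hempty ⟨G, mem_edgeFamily.2 ⟨hdiag, fun v => le_antisymm (hdeg v) (h v)⟩⟩
  -- By parity the total deficiency is at least two; `v = u` is allowed if `u` alone lacks two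
  -- edges.
  obtain ⟨v, hv⟩ : ∃ v, edgeDeg G v + ((if v = u then 1 else 0) + 1) ≤ d v := by
    by_contra! h
    have h1 : ∀ v, d v ≤ edgeDeg G v + if v = u then 1 else 0 := fun v => by
      have := h v
      omega
    have h2 : ∑ v, d v ≤ ∑ v, edgeDeg G v + 1 := by
      refine (Finset.sum_le_sum fun v _ => h1 v).trans ?_
      rw [Finset.sum_add_distrib]
      simp
    have h3 : ∑ v, edgeDeg G v < ∑ v, d v :=
      Finset.sum_lt_sum (fun v _ => hdeg v) ⟨u, Finset.mem_univ _, hu⟩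
    obtain ⟨c, hc⟩ := heven
    omega
  have hclique : ∀ w, edgeDeg G w < d w → w ∈ insert u (nbrs G u) := by
    intro w hw
    by_contra hnot
    rw [Finset.mem_insert, mem_nbrs, not_or] at hnot
    have h1 := hlarger (insert s(u, w) G) (by
      intro e he
      rcases Finset.mem_insert.1 he with rfl | he
      · simpa using Ne.symm hnot.1
      · exact hdiag e he) (by
      intro z
      rw [edgeDeg_insert hnot.2 (Ne.symm hnot.1)]
      have := hdeg z
      by_cases h1 : z = u
      · subst h1
        simp [Ne.symm hnot.1]
        omega
      · by_cases h2 : z = w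
        · subst h2
          simp [hnot.1]
          omega
        · simpa [h1, h2] using this)
    rw [Finset.card_insert_of_notMem hnot.2] at h1
    omega
  have hdef : ∑ v, d v ≤ ∑ v, edgeDeg G v + K := by
    have h1 : ∀ v, d v ≤ edgeDeg G v + if v ∈ insert u (nbrs G u) then d v else 0 := by
      intro v
      by_cases h : edgeDeg G v < d v
      · rw [if_pos (hclique v h)]
        omega
      · omega
    refine (Finset.sum_le_sum fun v _ => h1 v).trans ?_
    rw [Finset.sum_add_distrib, ← Finset.sum_filter, Finset.filter_mem_eq_inter,
      Finset.univ_inter]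
    exact Nat.add_le_add_left (hK G hdeg u) _
  have hsw := card_arcs_le_card_switchArcs hK hdeg (Finset.Subset.refl G) u v
  rw [card_arcs] at hsw
  obtain ⟨⟨x, y⟩, hxy⟩ : (switchArcs G G u v).Nonempty := by
    rw [← Finset.card_pos]
    omega
  rw [mem_switchArcs] at hxy
  obtain ⟨hxyG, ⟨hxu, hux⟩, hyv, hvy⟩ := hxy
  simp only at hxyG hxu hux hyv hvy
  have hxyne : x ≠ y := by simpa using hdiag _ hxyG
  have hne : s(u, x) ≠ s(v, y) := by
    intro h
    rw [Sym2.eq_iff] at h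
    rcases h with ⟨_, h⟩ | ⟨h1, h2⟩
    · exact hxyne h
    · subst h1 h2
      rw [Sym2.eq_swap] at hux
      exact hux hxyG
  have hvy' : s(v, y) ∉ G.erase s(x, y) := fun h => hvy (Finset.mem_of_mem_erase h)
  have hux' : s(u, x) ∉ insert s(v, y) (G.erase s(x, y)) := by
    rw [Finset.mem_insert, not_or]
    exact ⟨hne, fun h => hux (Finset.mem_of_mem_erase h)⟩
  have herase : ∀ z, edgeDeg (G.erase s(x, y)) z +
      ((if z = x then 1 else 0) + if z = y then 1 else 0) = edgeDeg G z := by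
    intro z
    rw [← edgeDeg_insert (Finset.notMem_erase _ _) hxyne, Finset.insert_erase hxyG]
  have h1 := hlarger (insert s(u, x) (insert s(v, y) (G.erase s(x, y)))) (by
    intro e he
    rcases Finset.mem_insert.1 he with rfl | he
    · simpa using hxu.symm
    · rcases Finset.mem_insert.1 he with rfl | he
      · simpa using hyv.symm
      · exact hdiag e (Finset.mem_of_mem_erase he)) (by
    intro z
    rw [edgeDeg_insert hux' hxu.symm, edgeDeg_insert hvy' hyv.symm]
    have e1 := herase z
    have e2 := hdeg z
    by_cases hzu : z = u
    · by_cases hzv : z = v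
      · subst hzu
        subst hzv
        simp only [if_true] at hv ⊢
        omega
      · subst hzu
        simp only [hzv, if_true, if_false]
        omega
    · by_cases hzv : z = v
      · subst hzv
        simp only [hzu, if_true, if_false] at hv ⊢
        omega
      · simp only [hzu, hzv, if_false]
        omega)
  rw [Finset.card_insert_of_notMem hux', Finset.card_insert_of_notMem hvy',
    Finset.card_erase_add_one hxyG] at h1
  omega

end EdgeSets

/-- At most `maxDeg d` neighbours contribute `J d`, and the vertex itself contributes at most
another `J d`. -/
theorem nbhdBound_two_mul_J {n : ℕ} {d : Fin n → ℕ} (hd : Antitone d) :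
    NbhdBound d (2 * J d) := by
  intro G hG a
  have h1 : ∑ v ∈ nbrs G a, d v ≤ J d := by
    refine sum_le_J hd _ ?_
    rw [card_nbrs]
    exact (hG a).trans (Finset.le_sup (Finset.mem_univ a))
  have h2 := le_J hd a
  by_cases ha : a ∈ nbrs G a
  · rw [Finset.insert_eq_of_mem ha]
    omega
  · rw [Finset.sum_insert ha]
    omega

/-! ### The switching that creates a prescribed edge. -/

section Switching

variable {V : Type*} [DecidableEq V]

/-- The edges removed by a switching. -/
def switchOld (j k a b x y : V) : Finset (Sym2 V) := {s(j, a), s(k, b), s(x, y)}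

/-- The edges added by a switching. -/
def switchNew (j k a b x y : V) : Finset (Sym2 V) := {s(j, k), s(a, x), s(b, y)}

theorem edgeDeg_triple {u₁ w₁ u₂ w₂ u₃ w₃ : V} (h₁ : u₁ ≠ w₁) (h₂ : u₂ ≠ w₂) (h₃ : u₃ ≠ w₃)
    (h₁₂ : s(u₁, w₁) ≠ s(u₂, w₂)) (h₁₃ : s(u₁, w₁) ≠ s(u₃, w₃)) (h₂₃ : s(u₂, w₂) ≠ s(u₃, w₃))
    (v : V) :
    edgeDeg {s(u₁, w₁), s(u₂, w₂), s(u₃, w₃)} v =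
      ((if v = u₃ then 1 else 0) + if v = w₃ then 1 else 0) +
      ((if v = u₂ then 1 else 0) + if v = w₂ then 1 else 0) +
      ((if v = u₁ then 1 else 0) + if v = w₁ then 1 else 0) := by
  rw [edgeDeg_insert (by simp only [Finset.mem_insert, Finset.mem_singleton]; tauto) h₁,
    edgeDeg_insert (by simp only [Finset.mem_singleton]; tauto) h₂,
    ← insert_empty_eq, edgeDeg_insert (by simp) h₃, edgeDeg_empty, zero_add]

variable [Fintype V]

/-- Counted with multiplicity, each of `j, k, a, b, x, y` loses one edge and gains one. Coincidences
such as `a = b`, `x = k` or `y = j` are therefore harmless as long as the three old edges are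
distinct and the three new ones are distinct. `H` survives because only edges outside it are
removed. -/
theorem switch_mem {d : V → ℕ} {H G : Finset (Sym2 V)} (hG : G ∈ above (edgeFamily d) H)
    {j k a b x y : V} (hjk : j ≠ k) (hjkG : s(j, k) ∉ G) (ha : s(j, a) ∈ G \ H)
    (hb : s(k, b) ∈ G \ H) (hxy : (x, y) ∈ switchArcs G (G \ H) a b) :
    switchOld j k a b x y ⊆ G ∧ Disjoint G (switchNew j k a b x y) ∧
      (G \ switchOld j k a b x y) ∪ switchNew j k a b x y ∈
        above (edgeFamily d) (insert s(j, k) H) ∧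
      s(a, x) ∈ ((G \ switchOld j k a b x y) ∪ switchNew j k a b x y) \ H ∧
      s(b, y) ∈ ((G \ switchOld j k a b x y) ∪ switchNew j k a b x y) \ H := by
  rw [mem_above, mem_edgeFamily] at hG
  obtain ⟨⟨hdiag, hdeg⟩, hHG⟩ := hG
  rw [mem_switchArcs] at hxy
  obtain ⟨hxyG, ⟨hxa, hax⟩, hyb, hby⟩ := hxy
  simp only at hxyG hxa hax hyb hby
  rw [Finset.mem_sdiff] at ha hb hxyG
  have hja : j ≠ a := by simpa using hdiag _ ha.1
  have hkb : k ≠ b := by simpa using hdiag _ hb.1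
  have hxy' : x ≠ y := by simpa using hdiag _ hxyG.1
  have hak : a ≠ k := by rintro rfl; exact hjkG ha.1
  have hbj : b ≠ j := by rintro rfl; exact hjkG (by rw [Sym2.eq_swap]; exact hb.1)
  have hay : a ≠ y := by rintro rfl; exact hax (by rw [Sym2.eq_swap]; exact hxyG.1)
  have hbx : b ≠ x := by rintro rfl; exact hby hxyG.1
  have hxj : x ≠ j := by rintro rfl; exact hax (by rw [Sym2.eq_swap]; exact ha.1)
  have hyk : y ≠ k := by rintro rfl; exact hby (by rw [Sym2.eq_swap]; exact hb.1)
  have o12 : s(j, a) ≠ s(k, b) := by rw [Ne, Sym2.eq_iff]; tauto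
  have o13 : s(j, a) ≠ s(x, y) := by rw [Ne, Sym2.eq_iff]; tauto
  have o23 : s(k, b) ≠ s(x, y) := by
    rw [Ne, Sym2.eq_iff]
    rintro (⟨_, h⟩ | ⟨h, _⟩)
    · exact hyb h.symm
    · exact hyk h.symm
  have n12 : s(j, k) ≠ s(a, x) := by rw [Ne, Sym2.eq_iff]; tauto
  have n13 : s(j, k) ≠ s(b, y) := by
    rw [Ne, Sym2.eq_iff]
    rintro (⟨h, _⟩ | ⟨_, h⟩)
    · exact hbj h.symm
    · exact hkb h
  have n23 : s(a, x) ≠ s(b, y) := by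
    rw [Ne, Sym2.eq_iff]
    rintro (⟨_, h⟩ | ⟨h, _⟩)
    · exact hxy' h
    · exact hay h
  have hold : switchOld j k a b x y ⊆ G := by
    simp only [switchOld, Finset.insert_subset_iff, Finset.singleton_subset_iff]
    exact ⟨ha.1, hb.1, hxyG.1⟩
  have hnew : Disjoint G (switchNew j k a b x y) := by
    simp only [switchNew, Finset.disjoint_insert_right, Finset.disjoint_singleton_right]
    exact ⟨hjkG, hax, hby⟩
  have hnew' : Disjoint (G \ switchOld j k a b x y) (switchNew j k a b x y) :=
    Finset.disjoint_of_subset_left Finset.sdiff_subset hnew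
  refine ⟨hold, hnew, ?_, ?_, ?_⟩
  · rw [mem_above, mem_edgeFamily]
    refine ⟨⟨?_, ?_⟩, ?_⟩
    · intro e he
      rcases Finset.mem_union.1 he with he | he
      · exact hdiag e (Finset.mem_sdiff.1 he).1
      · simp only [switchNew, Finset.mem_insert, Finset.mem_singleton] at he
        rcases he with rfl | rfl | rfl
        · simpa using hjk
        · simpa using hxa.symm
        · simpa using hyb.symm
    · intro v
      have e1 := edgeDeg_sdiff hold v
      rw [edgeDeg_union hnew', ← hdeg v, ← e1]
      congr 1
      rw [switchNew, switchOld, edgeDeg_triple hjk hxa.symm hyb.symm n12 n13 n23,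
        edgeDeg_triple hja hkb hxy' o12 o13 o23]
      ring
    · rw [Finset.insert_subset_iff]
      refine ⟨Finset.mem_union_right _ (by simp [switchNew]), fun e he =>
        Finset.mem_union_left _ (Finset.mem_sdiff.2 ⟨hHG he, fun h => ?_⟩)⟩
      simp only [switchOld, Finset.mem_insert, Finset.mem_singleton] at h
      rcases h with rfl | rfl | rfl
      · exact ha.2 he
      · exact hb.2 he
      · exact hxyG.2 he
  · rw [Finset.mem_sdiff]
    exact ⟨Finset.mem_union_right _ (by simp [switchNew]), fun h => hax (hHG h)⟩
  · rw [Finset.mem_sdiff]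
    exact ⟨Finset.mem_union_right _ (by simp [switchNew]), fun h => hby (hHG h)⟩

theorem edgeDeg_sdiff_of_mem_above {d : V → ℕ} {H G : Finset (Sym2 V)}
    (hG : G ∈ above (edgeFamily d) H) (v : V) :
    edgeDeg (G \ H) v = d v - edgeDeg H v := by
  rw [mem_above, mem_edgeFamily] at hG
  rw [← hG.1.2 v, ← edgeDeg_sdiff hG.2 v, Nat.add_sub_cancel]

theorem card_arcs_of_mem_above {d : V → ℕ} {m : ℕ} (hm : ∀ G ∈ edgeFamily d, G.card = m)
    {H G : Finset (Sym2 V)} (hG : G ∈ above (edgeFamily d) H) :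
    (arcs (G \ H)).card = 2 * (m - H.card) := by
  rw [mem_above] at hG
  rw [card_arcs, sum_edgeDeg fun e he => (mem_edgeFamily.1 hG.1).1 e (Finset.mem_sdiff.1 he).1,
    Finset.card_sdiff_of_subset hG.2, hm G hG.1]

/-- Double counting of switchings. Forwards, `ja` and `kb` are unexposed edges at `j` and `k`, and
all but `2 * K` arcs `(x, y)` are admissible. Backwards, the new graph and its two unexposed arcs
`(a, x)`, `(b, y)` determine the switching. The loss stands on the right to avoid truncated
subtraction. -/
theorem card_switch_le {d : V → ℕ} {K m : ℕ} (hK : NbhdBound d K)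
    (hm : ∀ G ∈ edgeFamily d, G.card = m) (H : Finset (Sym2 V)) {j k : V} (hjk : j ≠ k) :
    ((above (edgeFamily d) H).filter (s(j, k) ∉ ·)).card *
        ((d j - edgeDeg H j) * (d k - edgeDeg H k) * (2 * (m - H.card))) ≤
      (above (edgeFamily d) (insert s(j, k) H)).card *
        ((2 * (m - H.card)) * (2 * (m - H.card))) +
      ((above (edgeFamily d) H).filter (s(j, k) ∉ ·)).card *
        ((d j - edgeDeg H j) * (d k - edgeDeg H k) * (2 * K)) := by
  classical
  set O := (above (edgeFamily d) H).filter (s(j, k) ∉ ·) with hO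
  have hOab : ∀ G ∈ O, G ∈ above (edgeFamily d) H := fun G hG => (Finset.mem_filter.1 hG).1
  set X : Finset (Σ _ : Finset (Sym2 V), Σ _ : V × V, V × V) := O.sigma fun G =>
    (nbrs (G \ H) j ×ˢ nbrs (G \ H) k).sigma fun ab => switchArcs G (G \ H) ab.1 ab.2 with hX
  set Y : Finset (Σ _ : Finset (Sym2 V), (V × V) × (V × V)) :=
    (above (edgeFamily d) (insert s(j, k) H)).sigma fun G => arcs (G \ H) ×ˢ arcs (G \ H) with hY
  have hYcard : Y.card = (above (edgeFamily d) (insert s(j, k) H)).card *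
      ((2 * (m - H.card)) * (2 * (m - H.card))) := by
    rw [hY, Finset.card_sigma]
    refine Finset.sum_const_nat fun G hG => ?_
    have : G ∈ above (edgeFamily d) H := by
      rw [mem_above, Finset.insert_subset_iff] at hG
      exact mem_above.2 ⟨hG.1, hG.2.2⟩
    rw [Finset.card_product, card_arcs_of_mem_above hm this]
  have hXcard : O.card * ((d j - edgeDeg H j) * (d k - edgeDeg H k) * (2 * (m - H.card))) ≤
      X.card + O.card * ((d j - edgeDeg H j) * (d k - edgeDeg H k) * (2 * K)) := by
    rw [hX, Finset.card_sigma, ← smul_eq_mul, ← Finset.sum_const, ← smul_eq_mul O.card,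
      ← Finset.sum_const, ← Finset.sum_add_distrib]
    refine Finset.sum_le_sum fun G hG => ?_
    have hG' := hOab G hG
    rw [Finset.card_sigma, ← edgeDeg_sdiff_of_mem_above hG', ← edgeDeg_sdiff_of_mem_above hG',
      ← card_nbrs, ← card_nbrs, ← Finset.card_product, ← smul_eq_mul, ← Finset.sum_const,
      ← smul_eq_mul _ (2 * K), ← Finset.sum_const, ← Finset.sum_add_distrib]
    refine Finset.sum_le_sum fun ab _ => ?_
    rw [← card_arcs_of_mem_above hm hG']
    rw [mem_above] at hG'
    exact card_arcs_le_card_switchArcs hK (fun v => ((mem_edgeFamily.1 hG'.1).2 v).le)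
      Finset.sdiff_subset _ _
  have hXY : X.card ≤ Y.card := by
    have hmem : ∀ p ∈ X, p.1 ∈ above (edgeFamily d) H ∧ s(j, k) ∉ p.1 ∧
        s(j, p.2.1.1) ∈ p.1 \ H ∧ s(k, p.2.1.2) ∈ p.1 \ H ∧
        (p.2.2.1, p.2.2.2) ∈ switchArcs p.1 (p.1 \ H) p.2.1.1 p.2.1.2 := by
      intro p hp
      simp only [hX, hO, Finset.mem_sigma, Finset.mem_filter, Finset.mem_product,
        mem_nbrs] at hp
      exact ⟨hp.1.1, hp.1.2, hp.2.1.1, hp.2.1.2, hp.2.2⟩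
    refine Finset.card_le_card_of_injOn (fun p =>
      ⟨(p.1 \ switchOld j k p.2.1.1 p.2.1.2 p.2.2.1 p.2.2.2) ∪
        switchNew j k p.2.1.1 p.2.1.2 p.2.2.1 p.2.2.2,
        ((p.2.1.1, p.2.2.1), (p.2.1.2, p.2.2.2))⟩) ?_ ?_
    · intro p hp
      obtain ⟨h1, h2, h3, h4, h5⟩ := hmem p hp
      obtain ⟨-, -, h6, h7, h8⟩ := switch_mem h1 hjk h2 h3 h4 h5
      simp only [hY, Finset.coe_sigma, Set.mem_sigma_iff, Finset.mem_coe, Finset.mem_product,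
        mem_arcs]
      exact ⟨h6, h7, h8⟩
    · rintro ⟨G₁, ⟨a₁, b₁⟩, x₁, y₁⟩ hp₁ ⟨G₂, ⟨a₂, b₂⟩, x₂, y₂⟩ hp₂ heq
      obtain ⟨h1, h2, h3, h4, h5⟩ := hmem _ hp₁
      obtain ⟨g1, g2, g3, g4, g5⟩ := hmem _ hp₂
      obtain ⟨h6, h7, -⟩ := switch_mem h1 hjk h2 h3 h4 h5
      obtain ⟨g6, g7, -⟩ := switch_mem g1 hjk g2 g3 g4 g5
      simp only [Sigma.mk.injEq, heq_eq_eq, Prod.mk.injEq] at heq h6 h7 g6 g7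
      obtain ⟨heq, ⟨rfl, rfl⟩, rfl, rfl⟩ := heq
      -- The arcs fix both the removed and the added triple, so the old graph can be recovered.
      have hrec : ∀ G O N : Finset (Sym2 V), O ⊆ G → Disjoint G N →
          ((G \ O) ∪ N) \ N ∪ O = G := by
        intro G O N hOG hGN
        rw [Finset.union_sdiff_cancel_right
          (Finset.disjoint_of_subset_left Finset.sdiff_subset hGN),
          Finset.sdiff_union_of_subset hOG]
      have : G₁ = G₂ := by
        rw [← hrec _ _ _ h6 h7, ← hrec _ _ _ g6 g7, heq]
      subst this
      rfl
  rw [← hYcard]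
  omega

end Switching

/-! ### Poisson numbers of samples. -/

section Poisson

/-- The Poisson distribution as a probability mass function. -/
def poisPMF (r : NNReal) : PMF ℕ := (poissonMeasure r).toPMF

theorem poisPMF_apply (r : NNReal) (k : ℕ) :
    poisPMF r k = ENNReal.ofReal (Real.exp (-r) * r ^ k / k.factorial) := by
  rw [poisPMF, Measure.toPMF_apply, poissonMeasure_singleton]

theorem tsum_poisPMF_mul_pow (r : NNReal) (z : ℝ) (hz : 0 ≤ z) :
    ∑' k, poisPMF r k * ENNReal.ofReal z ^ k = ENNReal.ofReal (Real.exp (r * (z - 1))) := by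
  have hterm : ∀ k : ℕ, poisPMF r k * ENNReal.ofReal z ^ k =
      ENNReal.ofReal (Real.exp (-r) * ((r * z) ^ k / k.factorial)) := by
    intro k
    rw [poisPMF_apply, ← ENNReal.ofReal_pow hz, ← ENNReal.ofReal_mul (by positivity), mul_pow]
    congr 1
    ring
  have hsum : HasSum (fun k : ℕ => Real.exp (-r) * ((r * z) ^ k / k.factorial))
      (Real.exp (r * (z - 1))) := by
    have h := (NormedSpace.expSeries_div_hasSum_exp ((r : ℝ) * z)).mul_left (Real.exp (-r))
    rw [← Real.exp_eq_exp_ℝ, ← Real.exp_add] at h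
    convert! h using 2
    ring
  simp_rw [hterm]
  rw [← ENNReal.ofReal_tsum_of_nonneg (fun k => by positivity) hsum.summable, hsum.tsum_eq]

/-- Markov's inequality for `z ^ N`. -/
theorem poisPMF_tail_le (r : NNReal) (z : ℝ) (hz : 1 ≤ z) (T : ℕ) :
    (poisPMF r).toOuterMeasure {k | T < k} ≤
      ENNReal.ofReal (Real.exp (r * (z - 1)) / z ^ T) := by
  have hz0 : 0 < z := by linarith
  have hzT : 0 < z ^ T := by positivity
  rw [ENNReal.ofReal_div_of_pos hzT, ENNReal.le_div_iff_mul_le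
    (Or.inl (by simpa using hzT)) (Or.inl ENNReal.ofReal_ne_top),
    ← tsum_poisPMF_mul_pow r z hz0.le, PMF.toOuterMeasure_apply, ← ENNReal.tsum_mul_right]
  refine ENNReal.tsum_le_tsum fun k => ?_
  by_cases hk : T < k
  · rw [Set.indicator_of_mem (by exact hk), ENNReal.ofReal_pow hz0.le]
    refine mul_le_mul_right (pow_le_pow_right₀ ?_ hk.le) _
    rw [← ENNReal.ofReal_one]
    exact ENNReal.ofReal_le_ofReal hz
  · rw [Set.indicator_of_notMem (by exact hk)]
    simp

variable {E : Type*} [DecidableEq E] [Fintype E]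

theorem sampleSet_void (q : E → ℝ) (hq0 : ∀ f, 0 ≤ q f) (hq1 : ∑ f, q f ≤ 1) (A : Finset E)
    (r : ℕ) (S : Finset E) :
    (sampleSet (samplePMF q hq0 hq1) r S).toOuterMeasure {S | Disjoint S A} =
      if Disjoint S A then ENNReal.ofReal (1 - ∑ f ∈ A, q f) ^ r else 0 := by
  induction r generalizing S with
  | zero =>
    rw [sampleSet, PMF.toOuterMeasure_pure_apply]
    simp
  | succ r ih =>
    rw [sampleSet, PMF.toOuterMeasure_bind_apply, tsum_fintype, Fintype.sum_option]
    simp only [ih, Option.elim_none, Option.elim_some, Finset.disjoint_insert_left]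
    by_cases hS : Disjoint S A
    · simp only [hS, and_true, if_true]
      have h1 : ∀ f, (samplePMF q hq0 hq1) (some f) *
          (if f ∉ A then ENNReal.ofReal (1 - ∑ f ∈ A, q f) ^ r else 0) =
          (if f ∉ A then ENNReal.ofReal (q f) else 0) *
            ENNReal.ofReal (1 - ∑ f ∈ A, q f) ^ r := by
        intro f
        rw [samplePMF, realPMF_apply]
        split_ifs <;> simp
      rw [Finset.sum_congr rfl fun f _ => h1 f, ← Finset.sum_mul, ← add_mul, pow_succ']
      congr 1
      rw [← Finset.sum_filter, samplePMF, realPMF_apply,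
        ← ENNReal.ofReal_sum_of_nonneg fun f _ => hq0 f, ← ENNReal.ofReal_add]
      · congr 1
        have h2 := Finset.sum_filter_add_sum_filter_not Finset.univ (· ∈ A) q
        rw [Finset.filter_mem_eq_inter, Finset.univ_inter] at h2
        rw [Option.elim_none]
        linarith
      · simpa using hq1
      · exact Finset.sum_nonneg fun f _ => hq0 f
    · simp [hS]

/-- The set of edges among a Poisson number of independent samples. -/
def poisSet (r : NNReal) (q : E → ℝ) (hq0 : ∀ f, 0 ≤ q f) (hq1 : ∑ f, q f ≤ 1) :
    PMF (Finset E) :=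
  (poisPMF r).bind fun N => sampleSet (samplePMF q hq0 hq1) N ∅

/-- Given `N` samples, `A` is missed with probability `(1 - q(A)) ^ N`; the Poisson generating
function turns this into `exp(-r q(A))`, which factorizes over `A`. These void probabilities encode
independence. -/
theorem poisSet_void (r : NNReal) (q : E → ℝ) (hq0 : ∀ f, 0 ≤ q f) (hq1 : ∑ f, q f ≤ 1)
    (A : Finset E) :
    (poisSet r q hq0 hq1).toOuterMeasure {S | Disjoint S A} =
      ENNReal.ofReal (∏ f ∈ A, Real.exp (-(r * q f))) := by
  rw [poisSet, PMF.toOuterMeasure_bind_apply]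
  simp only [sampleSet_void, Finset.disjoint_empty_left, if_true]
  have hA : ∑ f ∈ A, q f ≤ 1 :=
    (Finset.sum_le_sum_of_subset_of_nonneg (Finset.subset_univ _) fun f _ _ => hq0 f).trans hq1
  rw [tsum_poisPMF_mul_pow _ _ (by linarith), ← Real.exp_sum, Finset.sum_neg_distrib,
    ← Finset.mul_sum]
  congr 2
  ring

/-- Mixture over the number of samples; beyond `T` an independent coupling is used, and the whole
probability of that event is given up. -/
theorem exists_poisSet_coupling (r : NNReal) (q : E → ℝ) (hq0 : ∀ f, 0 ≤ q f)
    (hq1 : ∑ f, q f ≤ 1) (ν : PMF (Finset E)) (T : ℕ) (b : ENNReal)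
    (h : ∀ N ≤ T, ∃ γ : PMF (Finset E × Finset E),
      γ.map Prod.fst = sampleSet (samplePMF q hq0 hq1) N ∅ ∧ γ.map Prod.snd = ν ∧
      γ.toOuterMeasure {x | ¬ x.1 ⊆ x.2} ≤ b) :
    ∃ γ : PMF (Finset E × Finset E), γ.map Prod.fst = poisSet r q hq0 hq1 ∧
      γ.map Prod.snd = ν ∧
      γ.toOuterMeasure {x | ¬ x.1 ⊆ x.2} ≤ b + (poisPMF r).toOuterMeasure {k | T < k} := by
  have hex : ∀ N, ∃ γ : PMF (Finset E × Finset E),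
      γ.map Prod.fst = sampleSet (samplePMF q hq0 hq1) N ∅ ∧ γ.map Prod.snd = ν ∧
      (N ≤ T → γ.toOuterMeasure {x | ¬ x.1 ⊆ x.2} ≤ b) := by
    intro N
    by_cases hN : N ≤ T
    · obtain ⟨γ, h1, h2, h3⟩ := h N hN
      exact ⟨γ, h1, h2, fun _ => h3⟩
    · exact ⟨prodPMF _ _, prodPMF_map_fst _ _, prodPMF_map_snd _ _, fun h => absurd h hN⟩
  choose γ h1 h2 h3 using hex
  refine ⟨(poisPMF r).bind γ, ?_, ?_, ?_⟩
  · rw [PMF.map_bind, poisSet]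
    simp only [h1]
  · rw [PMF.map_bind]
    simp only [h2, PMF.bind_const]
  · rw [PMF.toOuterMeasure_bind_apply]
    calc ∑' N, poisPMF r N * (γ N).toOuterMeasure {x | ¬ x.1 ⊆ x.2}
        ≤ ∑' N, (poisPMF r N * b + Set.indicator {k | T < k} (poisPMF r) N) := by
          refine ENNReal.tsum_le_tsum fun N => ?_
          by_cases hN : N ≤ T
          · exact (mul_le_mul_right (h3 N hN) _).trans le_self_add
          · rw [Set.indicator_of_mem (by simpa using hN)]
            refine le_trans ?_ le_add_self
            simpa using mul_le_mul_right (toOuterMeasure_le_one (γ N) _) (poisPMF r N)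
      _ = b + (poisPMF r).toOuterMeasure {k | T < k} := by
          rw [ENNReal.tsum_add, ENNReal.tsum_mul_right, PMF.tsum_coe, one_mul,
            PMF.toOuterMeasure_apply]

end Poisson

/-! ### Transfer from edge sets to graph laws. -/

section Graphs

variable {n : ℕ}

instance : MeasurableSingletonClass (SimpleGraph (Fin n)) where
  measurableSet_singleton G := by
    have : ({G} : Set (SimpleGraph (Fin n))) =
        SimpleGraph.edgeSet ⁻¹' {G.edgeSet} := by
      ext G'
      simp
    rw [this]
    exact SimpleGraph.measurable_edgeSet (measurableSet_singleton _)

/-- Well-founded induction recovers each point mass, as `Iic a` is `a` together with smaller points.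
-/
theorem measure_ext_Iic {α : Type*} [Finite α] [PartialOrder α] [MeasurableSpace α]
    [MeasurableSingletonClass α] (μ ν : Measure α) [IsFiniteMeasure μ] [IsFiniteMeasure ν]
    (h : ∀ a, μ (Set.Iic a) = ν (Set.Iic a)) : μ = ν := by
  classical
  have := Fintype.ofFinite α
  refine Measure.ext_of_singleton fun a => ?_
  induction a using WellFoundedLT.induction with
  | ind a ih =>
    have hIic : Set.Iic a = {a} ∪ Set.Iio a := by
      ext b
      simp [le_iff_eq_or_lt]
    have hdisj : Disjoint ({a} : Set α) (Set.Iio a) := by simp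
    have hmeas : MeasurableSet (Set.Iio a) := (Set.toFinite _).measurableSet
    have h1 := h a
    rw [hIic, measure_union hdisj hmeas, measure_union hdisj hmeas] at h1
    have h2 : μ (Set.Iio a) = ν (Set.Iio a) := by
      rw [← Set.coe_toFinset (Set.Iio a), ← sum_measure_singleton, ← sum_measure_singleton]
      refine Finset.sum_congr rfl fun b hb => ih b ?_
      simpa using hb
    rw [h2] at h1
    exact (ENNReal.add_left_inj (measure_ne_top ν _)).1 h1

/-- The simple graph with the given edge set. -/
def toGraph (S : Finset (Sym2 (Fin n))) : SimpleGraph (Fin n) :=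
  SimpleGraph.fromEdgeSet (S : Set (Sym2 (Fin n)))

theorem toGraph_adj {S : Finset (Sym2 (Fin n))} {u v : Fin n} :
    (toGraph S).Adj u v ↔ s(u, v) ∈ S ∧ u ≠ v := by
  simp [toGraph]

theorem toGraph_mono {S T : Finset (Sym2 (Fin n))} (h : S ⊆ T) : toGraph S ≤ toGraph T :=
  SimpleGraph.fromEdgeSet_mono (by exact_mod_cast h)

theorem measurable_graphOfPairs : Measurable (graphOfPairs : (Pairs n → Prop) → _) :=
  measurable_of_countable _

theorem graphOfPairs_le_iff (ω : Pairs n → Prop) (G : SimpleGraph (Fin n)) :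
    graphOfPairs ω ≤ G ↔ ∀ e : Pairs n, ω e → G.Adj e.1.1 e.1.2 := by
  constructor
  · rintro h ⟨⟨j, k⟩, hjk⟩ he
    refine h ?_
    rw [graphOfPairs, SimpleGraph.fromRel_adj]
    exact ⟨ne_of_lt hjk, Or.inl ⟨hjk, he⟩⟩
  · intro h j k hjk
    rw [graphOfPairs, SimpleGraph.fromRel_adj] at hjk
    rcases hjk.2 with ⟨hlt, he⟩ | ⟨hlt, he⟩
    · exact h _ he
    · exact (h _ he).symm

theorem edgeModel_Iic (W : Matrix (Fin n) (Fin n) unitInterval) (G : SimpleGraph (Fin n)) :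
    edgeModel W (Set.Iic G) = open Classical in
      ∏ e : Pairs n, if G.Adj e.1.1 e.1.2 then 1 else
        ENNReal.ofReal (1 - (W e.1.1 e.1.2 : ℝ)) := by
  classical
  rw [edgeModel, Measure.map_apply measurable_graphOfPairs (Set.toFinite _).measurableSet]
  have hpre : graphOfPairs ⁻¹' (Set.Iic G) = Set.univ.pi fun e : Pairs n =>
      if G.Adj e.1.1 e.1.2 then (Set.univ : Set Prop) else {False} := by
    ext ω
    rw [Set.mem_preimage, Set.mem_Iic, graphOfPairs_le_iff, Set.mem_univ_pi]
    refine forall_congr' fun e => ?_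
    split_ifs with h <;> simp [h]
  rw [hpre, Measure.pi_pi]
  refine Finset.prod_congr rfl fun e _ => ?_
  split_ifs
  · simp
  · rw [bernoulliMeasure_apply _ (measurableSet_singleton _)]
    simp
    rw [← ENNReal.ofReal_coe_nnreal]
    rfl

instance (W : Matrix (Fin n) (Fin n) unitInterval) : IsProbabilityMeasure (edgeModel W) :=
  Measure.isProbabilityMeasure_map measurable_graphOfPairs.aemeasurable

theorem poisSet_map_toGraph (r : NNReal) (q : Sym2 (Fin n) → ℝ) (hq0 : ∀ f, 0 ≤ q f)
    (hq1 : ∑ f, q f ≤ 1) (W : Matrix (Fin n) (Fin n) unitInterval)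
    (hW : ∀ j k, (W j k : ℝ) = 1 - Real.exp (-(r * q s(j, k)))) :
    ((poisSet r q hq0 hq1).map toGraph).toMeasure = edgeModel W := by
  classical
  refine measure_ext_Iic _ _ fun G => ?_
  rw [edgeModel_Iic, PMF.toMeasure_apply_eq_toOuterMeasure, PMF.toOuterMeasure_map_apply]
  set A : Finset (Sym2 (Fin n)) :=
    (Finset.univ.filter fun e : Pairs n => ¬ G.Adj e.1.1 e.1.2).image fun e => s(e.1.1, e.1.2)
    with hA
  have hpre : toGraph ⁻¹' (Set.Iic G) = {S : Finset (Sym2 (Fin n)) | Disjoint S A} := by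
    ext S
    rw [Set.mem_preimage, Set.mem_Iic, Set.mem_ofPred_eq, Finset.disjoint_right]
    simp only [hA, Finset.mem_image, Finset.mem_filter, Finset.mem_univ, true_and]
    constructor
    · rintro h _ ⟨e, he, rfl⟩ hS
      exact he (h (toGraph_adj.2 ⟨hS, ne_of_lt e.2⟩))
    · intro h j k hjk
      rw [toGraph_adj] at hjk
      by_contra hG
      rcases lt_or_gt_of_ne hjk.2 with hlt | hlt
      · exact h ⟨⟨(j, k), hlt⟩, hG, rfl⟩ hjk.1
      · refine h ⟨⟨(k, j), hlt⟩, fun h => hG h.symm, rfl⟩ ?_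
        rw [Sym2.eq_swap]
        exact hjk.1
  rw [hpre, poisSet_void, hA, Finset.prod_image, Finset.prod_filter,
    ENNReal.ofReal_prod_of_nonneg]
  · refine Finset.prod_congr rfl fun e _ => ?_
    by_cases h : G.Adj e.1.1 e.1.2
    · simp [h]
    · simp [h, hW]
  · intro e _
    split_ifs <;> positivity
  · rintro ⟨⟨j, k⟩, h⟩ _ ⟨⟨j', k'⟩, h'⟩ _ heq
    simp only [Sym2.eq_iff] at heq
    simp only [Subtype.mk.injEq, Prod.mk.injEq]
    rcases heq with heq | ⟨rfl, rfl⟩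
    · exact heq
    · exact absurd h (lt_asymm h')

theorem ncard_neighborSet_toGraph {G : Finset (Sym2 (Fin n))} (hG : ∀ e ∈ G, ¬ e.IsDiag)
    (v : Fin n) : ((toGraph G).neighborSet v).ncard = edgeDeg G v := by
  rw [← card_nbrs, ← Set.ncard_coe_finset]
  congr 1
  ext a
  simp only [SimpleGraph.mem_neighborSet, toGraph_adj, Finset.mem_coe, mem_nbrs]
  refine ⟨fun h => h.1, fun h => ⟨h, ?_⟩⟩
  simpa using hG _ h

theorem realizations_eq_image (d : Fin n → ℕ) :
    realizations d = toGraph '' (edgeFamily d : Set (Finset (Sym2 (Fin n)))) := by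
  classical
  ext G
  simp only [realizations, Set.mem_ofPred_eq, Set.mem_image, Finset.mem_coe, mem_edgeFamily]
  constructor
  · intro h
    have h1 : toGraph G.edgeFinset = G := by simp [toGraph]
    have h2 : ∀ e ∈ G.edgeFinset, ¬ e.IsDiag := fun e he =>
      G.not_isDiag_of_mem_edgeFinset he
    refine ⟨G.edgeFinset, ⟨h2, fun v => ?_⟩, h1⟩
    rw [← ncard_neighborSet_toGraph h2, h1, h v]
  · rintro ⟨S, ⟨h1, h2⟩, rfl⟩ v
    rw [ncard_neighborSet_toGraph h1, h2]

theorem toGraph_injOn (d : Fin n → ℕ) :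
    Set.InjOn toGraph (edgeFamily d : Set (Finset (Sym2 (Fin n)))) := by
  intro S hS T hT h
  rw [Finset.mem_coe, mem_edgeFamily] at hS hT
  have : ∀ S : Finset (Sym2 (Fin n)), (∀ e ∈ S, ¬ e.IsDiag) →
      (toGraph S).edgeSet = S := by
    intro S hS
    rw [toGraph, SimpleGraph.edgeSet_fromEdgeSet]
    ext e
    simp only [Set.mem_sdiff, Finset.mem_coe]
    exact ⟨fun h => h.1, fun h => ⟨h, hS e h⟩⟩
  rw [← Finset.coe_inj, ← this S hS.1, ← this T hT.1, h]

theorem unifPMF_map_toGraph {d : Fin n → ℕ} (hne : (edgeFamily d).Nonempty) :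
    ((unifPMF (edgeFamily d)).map toGraph).toMeasure = degreeModel d := by
  classical
  have hr : realizations d = ((edgeFamily d).image toGraph : Finset _) := by
    rw [realizations_eq_image, Finset.coe_image]
  refine Measure.ext_of_singleton fun G => ?_
  rw [PMF.toMeasure_apply_singleton _ _ (measurableSet_singleton _), degreeModel, hr,
    ← Finset.coe_singleton, uniformOn_apply_finset,
    Finset.card_image_of_injOn (toGraph_injOn d), PMF.map_apply, tsum_fintype,
    unifPMF_of_nonempty hne]
  by_cases hG : G ∈ (edgeFamily d).image toGraph
  · obtain ⟨S, hS, rfl⟩ := Finset.mem_image.1 hG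
    rw [Finset.sum_eq_single S]
    · rw [if_pos rfl, PMF.uniformOfFinset_apply_of_mem _ hS,
        Finset.inter_singleton_of_mem hG]
      simp
    · intro T _ hTS
      split_ifs with h
      · refine PMF.uniformOfFinset_apply_of_notMem _ fun hT => hTS ?_
        exact toGraph_injOn d hT hS h.symm
      · rfl
    · simp
  · rw [Finset.inter_singleton_of_notMem hG, Finset.sum_eq_zero]
    · simp
    · intro S _
      split_ifs with h
      · refine PMF.uniformOfFinset_apply_of_notMem _ fun hS => hG ?_
        rw [h]
        exact Finset.mem_image_of_mem _ hS
      · rfl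

theorem exists_graph_coupling {d : Fin n → ℕ} (hne : (edgeFamily d).Nonempty) (r : NNReal)
    (q : Sym2 (Fin n) → ℝ) (hq0 : ∀ f, 0 ≤ q f) (hq1 : ∑ f, q f ≤ 1)
    (W : Matrix (Fin n) (Fin n) unitInterval)
    (hW : ∀ j k, (W j k : ℝ) = 1 - Real.exp (-(r * q s(j, k)))) (b : ENNReal)
    (γ : PMF (Finset (Sym2 (Fin n)) × Finset (Sym2 (Fin n))))
    (h1 : γ.map Prod.fst = poisSet r q hq0 hq1)
    (h2 : γ.map Prod.snd = unifPMF (edgeFamily d))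
    (h3 : γ.toOuterMeasure {x | ¬ x.1 ⊆ x.2} ≤ b) :
    ∃ γ' : Measure (SimpleGraph (Fin n) × SimpleGraph (Fin n)),
      IsCoupling γ' (edgeModel W) (degreeModel d) ∧ 1 - b ≤ γ' {p | p.1 ≤ p.2} := by
  refine ⟨(γ.map (Prod.map toGraph toGraph)).toMeasure, ⟨inferInstance, ?_, ?_⟩, ?_⟩
  · rw [Measure.fst, PMF.toMeasure_map _ _ measurable_fst, PMF.map_comp,
      ← poisSet_map_toGraph r q hq0 hq1 W hW, ← h1, PMF.map_comp]
    rfl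
  · rw [Measure.snd, PMF.toMeasure_map _ _ measurable_snd, PMF.map_comp,
      ← unifPMF_map_toGraph hne, ← h2, PMF.map_comp]
    rfl
  · have hmeas : MeasurableSet {p : SimpleGraph (Fin n) × SimpleGraph (Fin n) | p.1 ≤ p.2} :=
      (Set.toFinite _).measurableSet
    have h4 : (γ.map (Prod.map toGraph toGraph)).toMeasure {p | p.1 ≤ p.2}ᶜ ≤ b := by
      rw [PMF.toMeasure_apply_eq_toOuterMeasure_apply _ hmeas.compl,
        PMF.toOuterMeasure_map_apply]
      refine le_trans (measure_mono ?_) h3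
      intro x hx hsub
      exact hx (toGraph_mono hsub)
    rw [tsub_le_iff_right]
    calc (1 : ENNReal) = (γ.map (Prod.map toGraph toGraph)).toMeasure {p | p.1 ≤ p.2} +
          (γ.map (Prod.map toGraph toGraph)).toMeasure {p | p.1 ≤ p.2}ᶜ :=
          (prob_add_prob_compl hmeas).symm
      _ ≤ _ := add_le_add_right h4 _

end Graphs

/-! ### The weights `P`, the density bound, and the tail bound for degrees. -/

section Weights

variable {n : ℕ} {d : Fin n → ℕ}

theorem P_symm (d : Fin n → ℕ) (j k : Fin n) : P d j k = P d k j := by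
  simp only [P, Matrix.of_apply, eq_comm (a := j), mul_comm (d j : ℝ)]

theorem P_self (d : Fin n → ℕ) (j : Fin n) : P d j j = 0 := by
  simp [P]

theorem P_of_ne (d : Fin n → ℕ) {j k : Fin n} (h : j ≠ k) :
    P d j k = ((d j : ℝ) * d k) / ((norm1 d : ℝ) + (d j : ℝ) * d k) := by
  simp [P, h]

theorem P_nonneg (d : Fin n → ℕ) (j k : Fin n) : 0 ≤ P d j k := by
  by_cases h : j = k
  · rw [h, P_self]
  · rw [P_of_ne d h]
    positivity

/-- The entries of `P d` as a function on unordered pairs. -/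
def pairP (d : Fin n → ℕ) : Sym2 (Fin n) → ℝ := Sym2.lift ⟨P d, P_symm d⟩

@[simp] theorem pairP_mk (d : Fin n → ℕ) (j k : Fin n) : pairP d s(j, k) = P d j k := rfl

theorem pairP_nonneg (d : Fin n → ℕ) (e : Sym2 (Fin n)) : 0 ≤ pairP d e := by
  induction e with
  | _ j k => exact P_nonneg d j k

theorem two_mul_sum_eq {V : Type*} [Fintype V] [DecidableEq V] (f : Sym2 V → ℝ)
    (hf : ∀ e : Sym2 V, e.IsDiag → f e = 0) : 2 * ∑ e, f e = ∑ v, ∑ a, f s(v, a) := by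
  have h1 : ∀ e : Sym2 V, 2 * f e = ∑ v : V, if v ∈ e then f e else 0 := by
    intro e
    by_cases he : e.IsDiag
    · simp [hf e he]
    · rw [← Finset.sum_filter, Finset.sum_const, nsmul_eq_mul]
      congr 1
      have : (Finset.univ.filter (· ∈ e)) = e.toFinset := by
        ext v
        simp
      rw [this, Sym2.card_toFinset_of_not_isDiag e he]
      norm_num
  rw [Finset.mul_sum, Finset.sum_congr rfl fun e _ => h1 e, Finset.sum_comm]
  refine Finset.sum_congr rfl fun v _ => ?_
  rw [← Finset.sum_filter]
  symm
  refine Finset.sum_bij (fun a _ => s(v, a)) ?_ ?_ ?_ ?_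
  · intro a _
    simp
  · intro a _ b _ h
    exact Sym2.congr_right.1 h
  · intro e he
    rw [Finset.mem_filter] at he
    obtain ⟨a, rfl⟩ := he.2
    exact ⟨a, Finset.mem_univ _, rfl⟩
  · intro a _
    rfl

theorem sum_pairP_le (hM : 0 < norm1 d) : 2 * ∑ e, pairP d e ≤ norm1 d := by
  have hM' : (0 : ℝ) < norm1 d := by exact_mod_cast hM
  have hsum : ∑ v, (d v : ℝ) = norm1 d := by
    rw [norm1]
    push_cast
    rfl
  rw [two_mul_sum_eq]
  · calc ∑ v, ∑ a, pairP d s(v, a) ≤ ∑ v, ∑ a, (d v : ℝ) * d a / norm1 d := by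
          refine Finset.sum_le_sum fun v _ => Finset.sum_le_sum fun a _ => ?_
          rw [pairP_mk]
          by_cases h : v = a
          · rw [h, P_self]
            positivity
          · rw [P_of_ne d h]
            have : (0 : ℝ) ≤ (d v : ℝ) * d a := by positivity
            gcongr
            linarith
      _ = norm1 d := by
          simp_rw [← Finset.sum_div, ← Finset.mul_sum, ← Finset.sum_mul, hsum]
          field_simp
  · intro e he
    induction e with
    | _ j k =>
      rw [Sym2.mk_isDiag_iff] at he
      rw [he, pairP_mk, P_self]

/-- Convexity of `exp` between `-p` and `0`. -/
theorem abs_one_sub_exp_sub_le {ε p : ℝ} (hε0 : 0 ≤ ε) (hε1 : ε ≤ 1) (hp : 0 ≤ p) :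
    |(1 - Real.exp (-((1 - ε) * p))) - (1 - Real.exp (-p))| ≤ ε * |1 - Real.exp (-p)| := by
  have h1 : Real.exp (-((1 - ε) * p)) ≤ (1 - ε) * Real.exp (-p) + ε := by
    have := convexOn_exp.2 (Set.mem_univ (-p)) (Set.mem_univ 0) (by linarith : 0 ≤ 1 - ε) hε0
      (by ring)
    simp only [smul_eq_mul, mul_zero, add_zero, Real.exp_zero, mul_one] at this
    rwa [mul_neg] at this
  have h2 : Real.exp (-p) ≤ Real.exp (-((1 - ε) * p)) := by
    rw [Real.exp_le_exp]
    nlinarith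
  have h3 : Real.exp (-p) ≤ 1 := by
    rw [Real.exp_le_one_iff]
    linarith
  rw [abs_of_nonneg (a := 1 - Real.exp (-p)) (by linarith), abs_of_nonpos (by linarith)]
  linarith

theorem card_of_mem_edgeFamily {m : ℕ} (hm : norm1 d = 2 * m) {G : Finset (Sym2 (Fin n))}
    (hG : G ∈ edgeFamily d) : G.card = m := by
  rw [mem_edgeFamily] at hG
  have := sum_edgeDeg hG.1
  rw [Finset.sum_congr rfl fun v _ => hG.2 v] at this
  have h2 : norm1 d = 2 * G.card := this
  omega

/-- Here `x` and `z` count the graphs with and without `jk`, and `s` is the unexposed fraction.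
Since the remaining degrees are about `s u` and `s v`, switching gives `x / z` at least about `s u v
/ (2 m)`; dividing `x / (x + z)` by `m - t = s m` cancels `s`. -/
theorem density_le_of_switch {ε m t x z rj rk u v J : ℝ} (hε0 : 0 < ε) (hε1 : ε < 1)
    (hmpos : 0 < m) (ht0 : 0 ≤ t) (hHm : t ≤ (1 - ε / 4) * m) (hJ : J ≤ ε ^ 2 / 256 * (2 * m))
    (hu0 : 0 ≤ u) (hv0 : 0 ≤ v) (hx0 : 0 ≤ x) (hz0 : 0 ≤ z) (htotal_pos : 0 < x + z)
    (hjr : (1 - ε / 16) * ((m - t) / m) * u ≤ rj) (hkr : (1 - ε / 16) * ((m - t) / m) * v ≤ rk)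
    (hsw' : z * (rj * rk * (2 * (m - t))) ≤
      x * ((2 * (m - t)) * (2 * (m - t))) + z * (rj * rk * (2 * (2 * J)))) :
    (1 - ε / 4) / m * (u * v / (2 * m + u * v)) ≤ x / ((x + z) * (m - t)) := by
  set s : ℝ := (m - t) / m with hs
  have hms : m - t = s * m := by
    rw [hs]
    field_simp
  have hsε : ε / 4 ≤ s := by
    rw [hs, le_div_iff₀ hmpos]
    linarith
  have hs1 : s ≤ 1 := by
    rw [hs, div_le_one hmpos]
    linarith
  have hspos : 0 < s := by linarith
  rw [hms] at hsw' ⊢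
  have hε16 : 0 < 1 - ε / 16 := by linarith
  -- The constant `256` is used here: as `s ≥ ε/4`, at most a fraction `ε/16` of the arcs is
  -- forbidden.
  have hJs : 4 * J ≤ ε / 16 * (2 * (s * m)) := by
    have h1 : ε ^ 2 / 256 * (2 * m) * 4 = ε / 16 * (2 * (ε / 4 * m)) := by ring
    have h2 : ε / 16 * (2 * (ε / 4 * m)) ≤ ε / 16 * (2 * (s * m)) := by gcongr
    linarith
  have hrr : (1 - ε / 16) * s * u * ((1 - ε / 16) * s * v) ≤ rj * rk :=
    mul_le_mul hjr hkr (by positivity) (le_trans (by positivity) hjr)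
  have hrr0 : 0 ≤ rj * rk := le_trans (by positivity) hrr
  have key1 : z * ((1 - ε / 16) * s * u * ((1 - ε / 16) * s * v)) * ((1 - ε / 16) * (2 * (s * m))) ≤
      x * (2 * (s * m)) * (2 * (s * m)) := by
    have h1 : z * ((1 - ε / 16) * s * u * ((1 - ε / 16) * s * v)) *
        ((1 - ε / 16) * (2 * (s * m))) ≤ z * (rj * rk) * ((1 - ε / 16) * (2 * (s * m))) := by
      gcongr
    have h2 : z * (rj * rk) * ((1 - ε / 16) * (2 * (s * m))) ≤
        z * (rj * rk) * (2 * (s * m) - 4 * J) := by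
      refine mul_le_mul_of_nonneg_left ?_ (by positivity)
      linarith
    linarith
  have key2 : z * ((1 - ε / 16) ^ 3 * s * (u * v)) ≤ x * (2 * m) := by
    have hpos : 0 < 2 * (s * m) * s := by positivity
    refine le_of_mul_le_mul_right ?_ hpos
    calc z * ((1 - ε / 16) ^ 3 * s * (u * v)) * (2 * (s * m) * s) =
        z * ((1 - ε / 16) * s * u * ((1 - ε / 16) * s * v)) * ((1 - ε / 16) * (2 * (s * m))) := by
          ring
      _ ≤ x * (2 * (s * m)) * (2 * (s * m)) := key1
      _ = x * (2 * m) * (2 * (s * m) * s) := by ring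
  -- Three factors `1 - ε/16` are lost, one for each remaining degree and one for the forbidden
  -- arcs.
  have hκ : 1 - ε / 4 ≤ (1 - ε / 16) ^ 3 := by nlinarith [sq_nonneg ε, mul_pos hε0 hε0]
  have huv : 0 ≤ u * v := by positivity
  have key3 : (1 - ε / 4) * s * (u * v) * (x + z) ≤ x * (2 * m + u * v) := by
    have h1 : (1 - ε / 4) * s * (u * v) * z ≤ (1 - ε / 16) ^ 3 * s * (u * v) * z := by gcongr
    have h2 : (1 - ε / 4) * s * (u * v) * x ≤ 1 * 1 * (u * v) * x := by
      gcongr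
      linarith
    linarith
  rw [div_mul_div_comm, div_le_div_iff₀ (by positivity) (by positivity)]
  calc (1 - ε / 4) * (u * v) * ((x + z) * (s * m)) =
      (1 - ε / 4) * s * (u * v) * (x + z) * m := by ring
    _ ≤ x * (2 * m + u * v) * m := by gcongr
    _ = x * (m * (2 * m + u * v)) := by ring

/-- If no vertex has lost too large a part of its degree to `H`, then the next exposed edge
dominates the rescaled `P d`. -/
theorem pairP_le_nextEdge {m : ℕ} (hm : norm1 d = 2 * m) (hd : Antitone d) {ε : ℝ} (hε0 : 0 < ε)
    (hε1 : ε < 1) (hJ : (J d : ℝ) ≤ ε ^ 2 / 256 * norm1 d) {H : Finset (Sym2 (Fin n))}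
    (hH : (above (edgeFamily d) H).Nonempty) (hHm : (H.card : ℝ) ≤ (1 - ε / 4) * m)
    (hlt : H.card < m)
    (hgood : ∀ j, (1 - ε / 16) * (((m : ℝ) - H.card) / m) * d j ≤ ((d j - edgeDeg H j : ℕ) : ℝ))
    {f : Sym2 (Fin n)} (hf : f ∉ H) :
    (1 - ε / 4) / m * pairP d f ≤ nextEdge (edgeFamily d) m H f := by
  induction f with
  | _ j k =>
  rw [pairP_mk]
  by_cases hjk : j = k
  · rw [hjk, P_self, mul_zero]
    exact nextEdge_nonneg hlt _
  have hcard : ∀ G ∈ edgeFamily d, G.card = m := fun G hG => card_of_mem_edgeFamily hm hG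
  have hsw := card_switch_le (nbhdBound_two_mul_J hd) hcard H hjk
  set O := ((above (edgeFamily d) H).filter (s(j, k) ∉ ·)).card with hO
  set I := (above (edgeFamily d) (insert s(j, k) H)).card with hI
  have htotal : I + O = (above (edgeFamily d) H).card := by
    rw [hI, hO, ← Finset.card_filter_add_card_filter_not (s := above (edgeFamily d) H)
      (fun G => s(j, k) ∈ G)]
    congr 2
    ext G
    simp only [mem_above, Finset.mem_filter, Finset.insert_subset_iff]
    tauto
  have htotal_pos : (0 : ℝ) < (I : ℝ) + O := by
    have : 0 < I + O := by rw [htotal]; exact hH.card_pos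
    exact_mod_cast this
  rw [nextEdge, if_neg hf, P_of_ne d hjk, ← htotal, ← hI]
  have hjr := hgood j
  have hkr := hgood k
  set rj := d j - edgeDeg H j
  set rk := d k - edgeDeg H k
  have hsw' : (O : ℝ) * (rj * rk * (2 * ((m : ℝ) - H.card))) ≤
      I * ((2 * ((m : ℝ) - H.card)) * (2 * ((m : ℝ) - H.card))) +
        O * (rj * rk * (2 * (2 * J d))) := by
    have := (Nat.cast_le (α := ℝ)).2 hsw
    simp only [Nat.cast_mul, Nat.cast_add, Nat.cast_ofNat, Nat.cast_sub hlt.le] at this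
    exact this
  have hmpos : (0 : ℝ) < m := by
    have : 0 < m := by omega
    exact_mod_cast this
  have hM : (norm1 d : ℝ) = 2 * m := by
    rw [hm]
    push_cast
    ring
  rw [hM] at hJ ⊢
  rw [Nat.cast_add]
  exact density_le_of_switch hε0 hε1 hmpos (Nat.cast_nonneg _) hHm hJ (Nat.cast_nonneg _)
    (Nat.cast_nonneg _) (Nat.cast_nonneg _) (Nat.cast_nonneg _) htotal_pos hjr hkr hsw'

/-- The exponent in the tail bound for the degrees. -/
def rate (ε : ℝ) : ℝ := ε + (1 - ε) * Real.log (1 - ε)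

theorem rate_pos {ε : ℝ} (h0 : 0 < ε) (h1 : ε < 1) : 0 < rate ε := by
  have hpos : 0 < 1 - ε := by linarith
  have h2 := Real.log_lt_sub_one_of_pos (inv_pos.2 hpos) (by
    rw [Ne, inv_eq_one]
    linarith)
  rw [Real.log_inv] at h2
  have h3 : (1 - ε) * (-Real.log (1 - ε)) < (1 - ε) * ((1 - ε)⁻¹ - 1) :=
    mul_lt_mul_of_pos_left h2 hpos
  rw [mul_sub, mul_inv_cancel₀ hpos.ne'] at h3
  unfold rate
  linarith

/-- The penalty factors of the potential. -/
def penalty (ε : ℝ) (m : ℕ) (d : Fin n → ℕ) (j : Fin n) (t : ℕ) : ℝ :=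
  Real.exp (-Real.log (1 - ε) * ((1 - ε) * (((m : ℝ) - t) / m) * d j))

/-- The penalty is `(1 - ε) ^ (-threshold)`, the Markov factor for the event that at most
`threshold` edges remain. -/
theorem one_le_penalty_mul {ε : ℝ} (h0 : 0 < ε) (h1 : ε < 1) {m : ℕ} {j : Fin n} {t r : ℕ}
    (h : (r : ℝ) ≤ (1 - ε) * (((m : ℝ) - t) / m) * d j) :
    1 ≤ penalty ε m d j t * (1 - ε) ^ r := by
  have hpos : 0 < 1 - ε := by linarith
  rw [penalty, ← Real.exp_log (pow_pos hpos r), ← Real.exp_add, Real.log_pow, Real.one_le_exp_iff]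
  have hlog : Real.log (1 - ε) < 0 := Real.log_neg hpos (by linarith)
  nlinarith

/-- The Chernoff bound for a lower tail by a factor `1 - ε` with mean `s * d j`; the base `1 - ε` is
the optimal one and yields `rate ε`. -/
theorem penalty_mul_pow_le {ε : ℝ} (h1 : ε < 1) {m t : ℕ} (ht : t ≤ m)
    (hm : 0 < m) (j : Fin n) :
    penalty ε m d j t * (1 - ε * (((m : ℝ) - t) / m)) ^ d j ≤
      Real.exp (-(rate ε * (((m : ℝ) - t) / m) * d j)) := by
  have hmpos : (0 : ℝ) < m := by exact_mod_cast hm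
  have ht' : (t : ℝ) ≤ m := by exact_mod_cast ht
  set s := ((m : ℝ) - t) / m with hs
  have hs1 : s ≤ 1 := by
    rw [hs, div_le_one hmpos]
    have : (0 : ℝ) ≤ t := by positivity
    linarith
  have hs0 : 0 ≤ s := div_nonneg (by linarith) hmpos.le
  have h2 : 0 ≤ 1 - ε * s := by nlinarith
  have h3 : (1 - ε * s) ^ d j ≤ Real.exp (-(ε * s)) ^ d j := by
    refine pow_le_pow_left₀ h2 ?_ _
    linarith [Real.add_one_le_exp (-(ε * s))]
  rw [← Real.exp_nat_mul] at h3
  calc penalty ε m d j t * (1 - ε * s) ^ d j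
      ≤ penalty ε m d j t * Real.exp (d j * -(ε * s)) :=
        mul_le_mul_of_nonneg_left h3 (Real.exp_nonneg _)
    _ = _ := by
        rw [penalty, ← Real.exp_add, rate]
        congr 1
        ring

/-- A union bound over at most `m` times and `n` vertices, with at least a fraction `η` of the edges
unexposed throughout. -/
theorem potential_empty_le {ε η D : ℝ} (hε0 : 0 < ε) (hε1 : ε < 1) {m : ℕ} (hm : 0 < m)
    (hD0 : 0 ≤ D) (hD : ∀ j, D ≤ d j) (r : ℕ) (hη : 0 ≤ η) (hr : (r : ℝ) ≤ (1 - η) * m)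
    (A : Fin n → Finset (Sym2 (Fin n))) :
    potential m (1 - ε) A d (penalty ε m d) r ∅ ≤
      m * n * Real.exp (-(rate ε * η * D)) := by
  have hmpos : (0 : ℝ) < m := by exact_mod_cast hm
  have hrm : (r : ℝ) ≤ m := hr.trans (by nlinarith)
  have hc := rate_pos hε0 hε1
  calc potential m (1 - ε) A d (penalty ε m d) r ∅
      ≤ ∑ i ∈ Finset.range r, ∑ _j : Fin n, Real.exp (-(rate ε * η * D)) := by
        refine Finset.sum_le_sum fun i hi => Finset.sum_le_sum fun j _ => ?_
        rw [Finset.mem_range] at hi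
        have hir : (i : ℝ) ≤ r := by exact_mod_cast hi.le
        have him : i ≤ m := by
          have : (i : ℝ) ≤ m := by linarith
          exact_mod_cast this
        have h1 := penalty_mul_pow_le (d := d) hε1 him hm j
        simp only [Finset.card_empty, zero_add, Finset.empty_inter, Nat.cast_zero, sub_zero,
          Nat.sub_zero, sub_sub_cancel]
        refine h1.trans ?_
        rw [Real.exp_le_exp, neg_le_neg_iff]
        have hs : η ≤ ((m : ℝ) - i) / m := by
          rw [le_div_iff₀ hmpos]
          linarith
        have := hD j
        have := hη.trans hs
        gcongr
    _ = r * n * Real.exp (-(rate ε * η * D)) := by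
        simp [mul_assoc]
    _ ≤ _ := by gcongr

end Weights

/-! ### The coupling for a fixed degree sequence and a fixed error. -/

section Main

variable {n : ℕ} {d : Fin n → ℕ}

/-- Uses `log (1 + ε/2) ≥ (ε/2) / (1 + ε/2)` and `(1 - 3ε/4)(1 + ε/2) = (1 - ε/4) - 3ε²/8`. -/
theorem tail_exponent_le {ε m lam : ℝ} {T : ℕ} (hε0 : 0 < ε) (hε1 : ε < 1)
    (hlam : lam ≤ (1 - 3 * ε / 4) * m) (hT : (1 - ε / 4) * m - 1 ≤ T) :
    Real.exp (lam * (1 + ε / 2 - 1)) / (1 + ε / 2) ^ T ≤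
      Real.exp (ε / 2 / (1 + ε / 2) * (1 - 3 * ε ^ 2 / 8 * m)) := by
  have hpos : 0 < 1 + ε / 2 := by linarith
  have hlog : ε / 2 / (1 + ε / 2) ≤ Real.log (1 + ε / 2) := by
    have := Real.one_sub_inv_le_log_of_pos hpos
    refine le_trans (le_of_eq ?_) this
    field_simp
    ring
  have hc : 0 < ε / 2 / (1 + ε / 2) := by positivity
  rw [← Real.exp_log (pow_pos hpos T), ← Real.exp_sub, Real.log_pow, Real.exp_le_exp]
  have h1 : (T : ℝ) * (ε / 2 / (1 + ε / 2)) ≤ T * Real.log (1 + ε / 2) := by gcongr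
  have h2 : ((1 - ε / 4) * m - 1) * (ε / 2 / (1 + ε / 2)) ≤ T * (ε / 2 / (1 + ε / 2)) := by
    gcongr
  have h3 : lam * (1 + ε / 2 - 1) ≤ (1 - 3 * ε / 4) * m * (ε / 2) := by
    rw [add_sub_cancel_left]
    gcongr
  have h4 : (1 - 3 * ε / 4) * m * (ε / 2) =
      ε / 2 / (1 + ε / 2) * ((1 - 3 * ε / 4) * m * (1 + ε / 2)) := by
    field_simp
  have h5 : ε / 2 / (1 + ε / 2) * ((1 - 3 * ε / 4) * m * (1 + ε / 2)) -
      ((1 - ε / 4) * m - 1) * (ε / 2 / (1 + ε / 2)) =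
      ε / 2 / (1 + ε / 2) * (1 - 3 * ε ^ 2 / 8 * m) := by ring
  linarith

theorem inter_filter_mem_card (H : Finset (Sym2 (Fin n))) (j : Fin n) :
    (H ∩ Finset.univ.filter (j ∈ ·)).card = edgeDeg H j := by
  rw [edgeDeg, Finset.inter_filter, Finset.inter_univ]

theorem edgeFamily_nonempty_of_J_le (hd : Antitone d) {m : ℕ} (hm : norm1 d = 2 * m)
    (hmpos : 0 < m) {ε : ℝ} (hε0 : 0 < ε) (hε1 : ε < 1)
    (hJ : (J d : ℝ) ≤ ε ^ 2 / 256 * norm1 d) : (edgeFamily d).Nonempty := by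
  refine edgeFamily_nonempty (nbhdBound_two_mul_J hd) ⟨m, by rw [← two_mul]; exact hm⟩ ?_
  have hM : (0 : ℝ) < norm1 d := by
    rw [hm]
    exact_mod_cast (by omega : 0 < 2 * m)
  have h1 : ε ^ 2 ≤ 1 := by nlinarith
  have h2 : ((3 * (2 * J d) : ℕ) : ℝ) < norm1 d := by
    push_cast
    nlinarith
  exact_mod_cast h2

theorem exists_coupling_of_bounds (hd : Antitone d) {m : ℕ} (hm : norm1 d = 2 * m)
    (hmpos : 0 < m) {ε : ℝ} (hε0 : 0 < ε) (hε1 : ε < 1)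
    (hJ : (J d : ℝ) ≤ ε ^ 2 / 256 * norm1 d) {D : ℝ} (hD0 : 0 ≤ D) (hD : ∀ j, D ≤ d j) :
    ∃ W : Matrix (Fin n) (Fin n) unitInterval, W.IsSymm ∧
      (∀ j k, |(W j k : ℝ) - (1 - Real.exp (-P d j k))| ≤ ε * |1 - Real.exp (-P d j k)|) ∧
      ∃ γ : Measure (SimpleGraph (Fin n) × SimpleGraph (Fin n)),
        IsCoupling γ (edgeModel W) (degreeModel d) ∧
        1 - ENNReal.ofReal (m * n * Real.exp (-(rate (ε / 16) * (ε / 4) * D)) +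
          Real.exp (ε / 2 / (1 + ε / 2) * (1 - 3 * ε ^ 2 / 8 * m))) ≤ γ {p | p.1 ≤ p.2} := by
  have hm0 : (0 : ℝ) < m := by exact_mod_cast hmpos
  have hne := edgeFamily_nonempty_of_J_le hd hm hmpos hε0 hε1 hJ
  have hcard : ∀ G ∈ edgeFamily d, G.card = m := fun G hG => card_of_mem_edgeFamily hm hG
  have hε4 : 0 < 1 - ε / 4 := by linarith
  set q : Sym2 (Fin n) → ℝ := fun e => (1 - ε / 4) / m * pairP d e with hq
  have hq0 : ∀ e, 0 ≤ q e := fun e => mul_nonneg (by positivity) (pairP_nonneg d e)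
  have hq1 : ∑ e, q e < 1 := by
    rw [hq, ← Finset.mul_sum]
    have h1 := sum_pairP_le (d := d) (by omega)
    rw [hm] at h1
    push_cast at h1
    calc (1 - ε / 4) / m * ∑ e, pairP d e ≤ (1 - ε / 4) / m * m := by
          gcongr
          linarith
      _ < 1 := by
          field_simp
          linarith
  -- Chosen so that `lam * q = (1 - ε) * P`.
  set lam : NNReal := ⟨(1 - ε) * m / (1 - ε / 4), div_nonneg (by nlinarith) hε4.le⟩ with hlam
  have hlam' : (lam : ℝ) = (1 - ε) * m / (1 - ε / 4) := rfl
  have hlq : ∀ j k, (lam : ℝ) * q s(j, k) = (1 - ε) * P d j k := by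
    intro j k
    have hqv : q s(j, k) = (1 - ε / 4) / m * P d j k := rfl
    have h4 : 4 - ε ≠ 0 := by linarith
    rw [hlam', hqv]
    field_simp
  set W : Matrix (Fin n) (Fin n) unitInterval := fun j k =>
    ⟨1 - Real.exp (-(lam * q s(j, k))), by
      have h1 : 0 ≤ (lam : ℝ) * q s(j, k) := mul_nonneg lam.2 (hq0 _)
      have h2 : Real.exp (-(lam * q s(j, k))) ≤ 1 := by
        rw [Real.exp_le_one_iff]
        linarith
      exact ⟨by linarith, by linarith [Real.exp_pos (-(lam * q s(j, k)))]⟩⟩ with hW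
  have hWval : ∀ j k, (W j k : ℝ) = 1 - Real.exp (-(lam * q s(j, k))) := fun j k => rfl
  refine ⟨W, ?_, ?_, ?_⟩
  · ext j k
    rw [Matrix.transpose_apply, hWval, hWval, Sym2.eq_swap]
  · intro j k
    rw [hWval, hlq]
    exact abs_one_sub_exp_sub_le hε0.le hε1.le (P_nonneg d j k)
  -- Exposure stops with about a fraction `ε/4` of the edges left; `T` still exceeds `lam ≤ (1 -
  -- 3ε/4) m` by order `ε m`, up to rounding.
  set T : ℕ := ⌊(1 - ε / 4) * m⌋₊ with hT
  have hTle : (T : ℝ) ≤ (1 - ε / 4) * m := Nat.floor_le (by positivity)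
  have hTm : T < m := by
    have : (T : ℝ) < m := by nlinarith
    exact_mod_cast this
  set A : Fin n → Finset (Sym2 (Fin n)) := fun j => Finset.univ.filter (j ∈ ·) with hA
  have hAcard : ∀ (H : Finset (Sym2 (Fin n))) j, (H ∩ A j).card = edgeDeg H j :=
    inter_filter_mem_card
  have hAd : ∀ j, ∀ G ∈ edgeFamily d, (G ∩ A j).card = d j := by
    intro j G hG
    rw [hAcard, (mem_edgeFamily.1 hG).2 j]
  have hy0 : 0 < 1 - ε / 16 := by linarith
  have hy1 : 1 - ε / 16 ≤ 1 := by linarith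
  have hC : ∀ j t, 0 ≤ penalty (ε / 16) m d j t := fun j t => Real.exp_nonneg _
  have hstep : ∀ r H, (above (edgeFamily d) H).Nonempty → H.card + r < T →
      1 ≤ potential m (1 - ε / 16) A d (penalty (ε / 16) m d) (r + 1) H ∨
      ((∀ f, f ∉ H → q f ≤ nextEdge (edgeFamily d) m H f) ∧
        ∑ f, nextEdge (edgeFamily d) m H f *
          potential m (1 - ε / 16) A d (penalty (ε / 16) m d) r (insert f H) ≤
            potential m (1 - ε / 16) A d (penalty (ε / 16) m d) (r + 1) H) := by
    intro r H hH hr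
    by_cases hgood : ∀ j, (1 - ε / 16) * (((m : ℝ) - H.card) / m) * d j ≤
        ((d j - edgeDeg H j : ℕ) : ℝ)
    · refine Or.inr ⟨fun f hf => ?_, sum_nextEdge_mul_potential_le hcard hH hy0 hy1 A d hAd _ hC r
        (by omega)⟩
      refine pairP_le_nextEdge hm hd hε0 hε1 hJ hH ?_ (by omega) hgood hf
      have : (H.card : ℝ) ≤ T := by exact_mod_cast (by omega : H.card ≤ T)
      linarith
    · left
      push Not at hgood
      obtain ⟨j, hj⟩ := hgood
      refine one_le_potential hy0 hy1 A d _ hC r (by omega) ⟨j, ?_⟩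
      rw [hAcard]
      exact one_le_penalty_mul (by linarith) (by linarith) hj.le
  have habove : above (edgeFamily d) ∅ = edgeFamily d := by simp [above]
  obtain ⟨γ, h1, h2, h3⟩ := exists_poisSet_coupling lam q hq0 hq1.le (unifPMF (edgeFamily d)) T
    (ENNReal.ofReal (m * n * Real.exp (-(rate (ε / 16) * (ε / 4) * D)))) (by
      intro N hN
      obtain ⟨γ, h1, h2, h3⟩ := exists_sampleSet_coupling hcard q hq0 hq1 T hTm.le
        (potential m (1 - ε / 16) A d (penalty (ε / 16) m d))
        (fun r H _ h => potential_nonneg hy0 hy1 A d _ hC r (by omega)) hstep N ∅ ∅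
        (by rwa [habove]) (by simpa using hN) (Finset.Subset.refl _)
      rw [habove] at h2
      refine ⟨γ, h1, h2, h3.trans (ENNReal.ofReal_le_ofReal ?_)⟩
      refine potential_empty_le (by linarith) (by linarith) hmpos hD0 hD N (by linarith) ?_ A
      have : (N : ℝ) ≤ T := by exact_mod_cast hN
      linarith)
  refine exists_graph_coupling hne lam q hq0 hq1.le W hWval _ γ h1 h2 (h3.trans ?_)
  rw [ENNReal.ofReal_add (by positivity) (by positivity)]
  gcongr
  refine (poisPMF_tail_le lam (1 + ε / 2) (by linarith) T).trans (ENNReal.ofReal_le_ofReal ?_)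
  refine tail_exponent_le hε0 hε1 ?_ ?_
  · rw [hlam', div_le_iff₀ hε4]
    nlinarith [mul_pos hε0 hε0, mul_pos (mul_pos hε0 hε0) hm0]
  · have := Nat.lt_floor_add_one ((1 - ε / 4) * (m : ℝ))
    linarith

theorem le_of_edgeFamily_nonempty (h : (edgeFamily d).Nonempty) (j : Fin n) : d j ≤ n := by
  obtain ⟨G, hG⟩ := h
  rw [← (mem_edgeFamily.1 hG).2 j, ← card_nbrs]
  exact (Finset.card_le_univ _).trans_eq (Fintype.card_fin n)

end Main

/-! ### Passage to the limit. -/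

theorem exists_tendsto_eventually (Q : ℕ → ℕ → Prop) (h : ∀ k, ∀ᶠ n in atTop, Q n k) :
    ∃ κ : ℕ → ℕ, Tendsto κ atTop atTop ∧ ∀ᶠ n in atTop, Q n (κ n) := by
  classical
  -- Diagonal choice: the largest admissible `k ≤ n`. It is admissible as soon as `Q n 0` holds.
  refine ⟨fun n => Nat.findGreatest (Q n) n, ?_, ?_⟩
  · rw [tendsto_atTop]
    intro K
    filter_upwards [h K, eventually_ge_atTop K] with n hn hK
    exact Nat.le_findGreatest hK hn
  · filter_upwards [h 0] with n hn
    exact Nat.findGreatest_spec (Nat.zero_le n) hn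

/-- The conclusion for a fixed degree sequence and a fixed error. -/
def HasCoupling {n : ℕ} (d : Fin n → ℕ) (ε : ℝ) : Prop :=
  ∃ W : Matrix (Fin n) (Fin n) unitInterval, W.IsSymm ∧
    (∀ j k, |(W j k : ℝ) - (1 - Real.exp (-P d j k))| ≤ ε * |1 - Real.exp (-P d j k)|) ∧
    ∃ γ : Measure (SimpleGraph (Fin n) × SimpleGraph (Fin n)),
      IsCoupling γ (edgeModel W) (degreeModel d) ∧
      1 - ENNReal.ofReal ε ≤ γ {p | p.1 ≤ p.2}

theorem eventually_hasCoupling (d : ∀ n : ℕ, Fin n → ℕ) (hd : ∀ n, Antitone (d n))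
    (heven : ∀ n, Even (norm1 (d n)))
    (hJ : (fun n => (J (d n) : ℝ)) =o[atTop] fun n => (norm1 (d n) : ℝ))
    (hδ : (fun n : ℕ => Real.log n) =o[atTop] fun n => (minDeg (d n) : ℝ))
    {ε : ℝ} (hε0 : 0 < ε) (hε1 : ε < 1) : ∀ᶠ n in atTop, HasCoupling (d n) ε := by
  set c := rate (ε / 16) * (ε / 4) with hc
  have hcpos : 0 < c := mul_pos (rate_pos (by linarith) (by linarith)) (by linarith)
  have htail : Tendsto (fun n : ℕ => Real.exp (ε / 2 / (1 + ε / 2) * (1 - 3 * ε ^ 2 / 16 * n)))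
      atTop (𝓝 0) := by
    rw [Real.tendsto_exp_comp_nhds_zero]
    refine Tendsto.const_mul_atBot (by positivity) ?_
    refine tendsto_const_nhds.add_atBot (tendsto_neg_atTop_atBot.comp ?_)
    exact Tendsto.const_mul_atTop (by positivity) tendsto_natCast_atTop_atTop
  -- The constant `c / 4` gives `exp(-c δ) ≤ n⁻⁴`, which beats `m * n ≤ n³`.
  filter_upwards [hJ.bound (c := ε ^ 2 / 256) (by positivity), hδ.bound (c := c / 4) (by positivity),
    eventually_ge_atTop 2, htail.eventually (gt_mem_nhds (by linarith : 0 < ε / 2)),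
    tendsto_one_div_atTop_nhds_zero_nat.eventually
      (gt_mem_nhds (by linarith : (0 : ℝ) < ε / 2))] with n h1 h2 hn h3 h4
  have hn2 : (2 : ℝ) ≤ n := by exact_mod_cast hn
  rw [Real.norm_natCast, Real.norm_natCast] at h1
  rw [Real.norm_natCast, Real.norm_of_nonneg (Real.log_nonneg (by linarith))] at h2
  have hmin : ∀ j, minDeg (d n) ≤ d n j := fun j => ciInf_le (OrderBot.bddBelow _) j
  have hminpos : 0 < minDeg (d n) := by
    have : 0 < c / 4 * (minDeg (d n) : ℝ) := (Real.log_pos (by linarith)).trans_le h2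
    have := pos_of_mul_pos_right this (by positivity)
    exact_mod_cast this
  obtain ⟨m, hm⟩ := heven n
  rw [← two_mul] at hm
  have hnm : n ≤ 2 * m := by
    rw [← hm, norm1]
    calc n = ∑ _j : Fin n, 1 := by simp
      _ ≤ _ := Finset.sum_le_sum fun j _ => hminpos.trans_le (hmin j)
  have hmpos : 0 < m := by omega
  have hne := edgeFamily_nonempty_of_J_le (hd n) hm hmpos hε0 hε1 h1
  have hmn : m ≤ n * n := by
    have : norm1 (d n) ≤ n * n := by
      calc norm1 (d n) ≤ ∑ _j : Fin n, n :=
            Finset.sum_le_sum fun j _ => le_of_edgeFamily_nonempty hne j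
        _ = n * n := by simp
    omega
  obtain ⟨W, hW1, hW2, γ, hγ1, hγ2⟩ := exists_coupling_of_bounds (hd n) hm hmpos hε0 hε1 h1
    (D := minDeg (d n)) (by positivity) (fun j => by exact_mod_cast hmin j)
  refine ⟨W, hW1, hW2, γ, hγ1, le_trans (tsub_le_tsub_left (ENNReal.ofReal_le_ofReal ?_) _) hγ2⟩
  have hnpos : (0 : ℝ) < n := by linarith
  have e1 : (m : ℝ) * n * Real.exp (-(c * minDeg (d n))) ≤ 1 / n := by
    have hexp : Real.exp (-(c * minDeg (d n))) ≤ ((n : ℝ) ^ 4)⁻¹ := by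
      rw [← Real.exp_log (pow_pos hnpos 4), ← Real.exp_neg, Real.exp_le_exp, Real.log_pow]
      push_cast
      linarith
    have hmn' : (m : ℝ) ≤ n * n := by exact_mod_cast hmn
    calc (m : ℝ) * n * Real.exp (-(c * minDeg (d n))) ≤ n * n * n * ((n : ℝ) ^ 4)⁻¹ := by gcongr
      _ = 1 / n := by
        field_simp
  have e2 : Real.exp (ε / 2 / (1 + ε / 2) * (1 - 3 * ε ^ 2 / 8 * m)) ≤
      Real.exp (ε / 2 / (1 + ε / 2) * (1 - 3 * ε ^ 2 / 16 * n)) := by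
    have hnm' : (n : ℝ) ≤ 2 * m := by exact_mod_cast hnm
    rw [Real.exp_le_exp]
    refine mul_le_mul_of_nonneg_left ?_ (by positivity)
    have : 3 * ε ^ 2 / 16 * (n : ℝ) ≤ 3 * ε ^ 2 / 16 * (2 * m) := by gcongr
    linarith
  linarith

end DegSeq

end

theorem mainTheorem1 (d : ∀ n : ℕ, Fin n → ℕ)
    (hd : ∀ n, Antitone (d n))
    (heven : ∀ n, Even (DegSeq.norm1 (d n)))
    (hJ : (fun n => (DegSeq.J (d n) : ℝ)) =o[atTop] fun n => (DegSeq.norm1 (d n) : ℝ))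
    (hδ : (fun n : ℕ => Real.log n) =o[atTop] fun n => (DegSeq.minDeg (d n) : ℝ)) :
    ∃ W : ∀ n : ℕ, Matrix (Fin n) (Fin n) unitInterval,
      (∀ n, (W n).IsSymm) ∧
      DegSeq.UniformlyAsymptotic (fun n => (W n).map fun x => (x : ℝ))
        (fun n => (DegSeq.P (d n)).map fun x => 1 - Real.exp (-x)) ∧
      ∃ γ : ∀ n : ℕ, Measure (SimpleGraph (Fin n) × SimpleGraph (Fin n)),
        (∀ᶠ n in atTop,
          DegSeq.IsCoupling (γ n) (DegSeq.edgeModel (W n)) (DegSeq.degreeModel (d n))) ∧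
        Tendsto (fun n => γ n {p | p.1 ≤ p.2}) atTop (𝓝 1) := by
  -- The shift by `2` keeps the error strictly below `1` even for `k = 0`.
  obtain ⟨κ, hκ, hQ⟩ := DegSeq.exists_tendsto_eventually
    (fun n k => DegSeq.HasCoupling (d n) (1 / ((k : ℝ) + 2))) fun k =>
      DegSeq.eventually_hasCoupling d hd heven hJ hδ (by positivity) (by
        rw [div_lt_one (by positivity)]
        have : (0 : ℝ) ≤ k := Nat.cast_nonneg k
        linarith)
  have hex : ∀ n, ∃ (W : Matrix (Fin n) (Fin n) unitInterval)
      (γ : Measure (SimpleGraph (Fin n) × SimpleGraph (Fin n))), W.IsSymm ∧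
      (DegSeq.HasCoupling (d n) (1 / ((κ n : ℝ) + 2)) →
        (∀ j k, |(W j k : ℝ) - (1 - Real.exp (-DegSeq.P (d n) j k))| ≤
          1 / ((κ n : ℝ) + 2) * |1 - Real.exp (-DegSeq.P (d n) j k)|) ∧
        DegSeq.IsCoupling γ (DegSeq.edgeModel W) (DegSeq.degreeModel (d n)) ∧
        1 - ENNReal.ofReal (1 / ((κ n : ℝ) + 2)) ≤ γ {p | p.1 ≤ p.2}) := by
    intro n
    by_cases h : DegSeq.HasCoupling (d n) (1 / ((κ n : ℝ) + 2))
    · obtain ⟨W, h1, h2, γ, h3, h4⟩ := h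
      exact ⟨W, γ, h1, fun _ => ⟨h2, h3, h4⟩⟩
    -- Arbitrary values; by `hQ` this case does not occur for large `n`.
    · exact ⟨0, 0, Matrix.isSymm_zero, fun h' => absurd h' h⟩
  choose W γ hsymm hprop using hex
  have hlim : Tendsto (fun n => 1 / ((κ n : ℝ) + 2)) atTop (𝓝 0) := by
    have h1 : Tendsto (fun n => (κ n : ℝ) + 2) atTop atTop :=
      tendsto_atTop_add_const_right _ _ (tendsto_natCast_atTop_atTop.comp hκ)
    simp only [one_div]
    exact h1.inv_tendsto_atTop
  refine ⟨W, hsymm, ?_, γ, hQ.mono fun n hn => (hprop n hn).2.1, ?_⟩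
  · intro ε hε
    filter_upwards [hQ, hlim.eventually (gt_mem_nhds hε)] with n hn hlt j k
    refine ((hprop n hn).1 j k).trans ?_
    simp only [Matrix.map_apply]
    gcongr
  · have hlow : Tendsto (fun n => 1 - ENNReal.ofReal (1 / ((κ n : ℝ) + 2))) atTop (𝓝 1) := by
      have h1 := ENNReal.Tendsto.sub (tendsto_const_nhds (x := (1 : ENNReal)))
        ((ENNReal.continuous_ofReal.tendsto 0).comp hlim) (Or.inl ENNReal.one_ne_top)
      simpa using h1
    refine tendsto_of_tendsto_of_tendsto_of_le_of_le' hlow tendsto_const_nhds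
      (hQ.mono fun n hn => (hprop n hn).2.2) (hQ.mono fun n hn => ?_)
    have := (hprop n hn).2.1.isProbabilityMeasure
    exact prob_le_one
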